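/- Let $(M,g)$ be a spacetime of dimension $n\ge 2$, i.e. a smooth $n$-manifold with a smooth Lorentzian metric $g$ of signature $(-,+,\dots,+)$ and a time orientation. Let $\theta$ be the canonical (Liouville) $1$-form on $T^*M$, $\theta_\alpha(W)=\alpha(d\pi\,W)$ with $\pi\colon T^*M\to M$ the projection, and let $\xi$ be the Euler vector field on $T^*M$, i.e. the generator of $\alpha\mapsto e^t\alpha$. Let $E_g\colon T^*M\to\mathbb R$, $E_g(\alpha)=g^*(\alpha,\alpha)$, where $g^*$ is the dual metric, and let $X_g$ be the symplectic gradient of $E_g$, defined by $-d\theta(X_g,\cdot)=dE_g$. Let $$\mathcal L^*M=\{\alpha\in T^*M\mid g^*(\alpha,\alpha)=0,\ \alpha\ne 0,\ \alpha=g(v,\cdot)\text{ for some future pointing } v\},$$ an embedded hypersurface of $T^*M$ to which $X_g$ and $\xi$ are tangent. Let $\mathcal N_g$ be the leaf space, with the quotient topology, of the $2$-dimensional foliation of $\mathcal L^*M$ tangent to the span of $X_g$ and $\xi$, and let $p\colon\mathcal L^*M\to\mathcal N_g$ be the projection. Suppose that the smooth structure of $\mathcal L^*M$ descends to $\mathcal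 N_g$, i.e. that $\mathcal N_g$ carries a smooth structure of dimension $2n-3$ (not necessarily Hausdorff), compatible with the quotient topology, for which $p$ is a smooth submersion. Then there is exactly one field $D$ of tangent subspaces $D_\kappa\subseteq T_\kappa\mathcal N_g$, $\kappa\in\mathcal N_g$, which is induced by the kernel of $\theta$, in the sense that $$(dp_\alpha)^{-1}(D_{p(\alpha)})=\ker\theta_\alpha\cap T_\alpha\mathcal L^*M\qquad\text{for all }\alpha\in\mathcal L^*M,$$ and $D$ is a contact structure on $\mathcal N_g$: locally $D=\ker\eta$ for a nowhere vanishing smooth $1$-form $\eta$ such that $d\eta$ is nondegenerate on $D$. -/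

import Mathlib

open Bundle Manifold
open scoped ContDiff Topology

noncomputable section

/-! ## Differential 1-forms and contact structures on manifolds without boundary -/

section Forms

variable {E H N : Type*} [NormedAddCommGroup E] [NormedSpace ℝ E] [TopologicalSpace H]
  [TopologicalSpace N] [ChartedSpace H N]

/-- The coordinate expression of the 1-form `η` in the preferred chart at `x₀`: the pullback of `η`
by the inverse of the chart. -/
def oneFormInChart (I : ModelWithCorners ℝ E H) [I.Boundaryless]
    (η : ∀ x : N, TangentSpace I x →L[ℝ] ℝ) (x₀ : N) (y : E) : E →L[ℝ] ℝ :=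
  (η ((extChartAt I x₀).symm y)).comp (mfderiv 𝓘(ℝ, E) I (extChartAt I x₀).symm y)

/-- The exterior derivative of the 1-form `η` at `x`, evaluated on two tangent vectors, computed
in the preferred chart `φ` at `x`:
`dη(v, w) = D η̃ (φ x) (dφ v) (dφ w) - D η̃ (φ x) (dφ w) (dφ v)`, where `η̃` is the coordinate
expression of `η`. -/
def oneFormExtDeriv (I : ModelWithCorners ℝ E H) [I.Boundaryless]
    (η : ∀ x : N, TangentSpace I x →L[ℝ] ℝ) (x : N) (v w : TangentSpace I x) : ℝ :=
  let dφ : TangentSpace I x →L[ℝ] E := mfderiv I 𝓘(ℝ, E) (extChartAt I x) x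
  let Dη : E →L[ℝ] E →L[ℝ] ℝ := fderiv ℝ (oneFormInChart I η x) (extChartAt I x x)
  Dη (dφ v) (dφ w) - Dη (dφ w) (dφ v)

/-- The 1-form `η` is smooth on `U`, as a section of the cotangent bundle. -/
def IsSmoothOneFormOn (I : ModelWithCorners ℝ E H) [IsManifold I 1 N]
    (η : ∀ x : N, TangentSpace I x →L[ℝ] ℝ) (U : Set N) : Prop :=
  ContMDiffOn I (I.prod 𝓘(ℝ, E →L[ℝ] ℝ)) ∞
    (fun x => TotalSpace.mk' (E →L[ℝ] ℝ) (E := fun x : N => TangentSpace I x →L[ℝ] ℝ) x (η x)) U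

/-- A field of tangent subspaces `D` is a contact structure: locally it is the kernel of a smooth
nowhere vanishing 1-form `η` (so `D` is a smooth field of hyperplanes) such that `dη` is
nondegenerate on `D`, i.e. `D` is maximally nonintegrable. -/
def IsContactStructure (I : ModelWithCorners ℝ E H) [I.Boundaryless] [IsManifold I 1 N]
    (D : ∀ x : N, Submodule ℝ (TangentSpace I x)) : Prop :=
  ∀ x₀ : N, ∃ U : Set N, IsOpen U ∧ x₀ ∈ U ∧
    ∃ η : ∀ x : N, TangentSpace I x →L[ℝ] ℝ, IsSmoothOneFormOn I η U ∧
      ∀ x ∈ U, η x ≠ 0 ∧ (∀ v : TangentSpace I x, v ∈ D x ↔ η x v = 0) ∧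
        ∀ v ∈ D x, (∀ w ∈ D x, oneFormExtDeriv I η x v w = 0) → v = 0

end Forms

/-! ## Spacetimes -/

/-- The model space of an `n`-dimensional manifold. -/
abbrev Euc (n : ℕ) : Type := EuclideanSpace ℝ (Fin n)

section Spacetime

variable (n : ℕ) (M : Type*) [TopologicalSpace M] [ChartedSpace (Euc n) M] [IsManifold (𝓡 n) ∞ M]

/-- A smooth Lorentzian metric of signature `(-, +, …, +)`: a smooth field of symmetric bilinear
forms on the tangent spaces such that every tangent space contains a timelike vector, and such that
the form is positive definite on the orthogonal complement of every timelike vector. -/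
structure LorentzianMetric where
  inner : ∀ x : M, TangentSpace (𝓡 n) x →L[ℝ] TangentSpace (𝓡 n) x →L[ℝ] ℝ
  symm : ∀ (x : M) (v w : TangentSpace (𝓡 n) x), inner x v w = inner x w v
  exists_timelike : ∀ x : M, ∃ v : TangentSpace (𝓡 n) x, inner x v v < 0
  pos_of_orthogonal : ∀ (x : M) (v w : TangentSpace (𝓡 n) x),
    inner x v v < 0 → inner x v w = 0 → w ≠ 0 → 0 < inner x w w
  contMDiff : ContMDiff (𝓡 n) ((𝓡 n).prod 𝓘(ℝ, Euc n →L[ℝ] Euc n →L[ℝ] ℝ)) ∞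
    (fun x => TotalSpace.mk' (Euc n →L[ℝ] Euc n →L[ℝ] ℝ)
      (E := fun x : M => TangentSpace (𝓡 n) x →L[ℝ] TangentSpace (𝓡 n) x →L[ℝ] ℝ) x (inner x))

/-- The cotangent bundle `T*M`, with the topology and smooth structure of Mathlib's bundle of
continuous linear maps. -/
abbrev CotangentBundle : Type _ :=
  TotalSpace (Euc n →L[ℝ] ℝ) (fun x : M => TangentSpace (𝓡 n) x →L[ℝ] ℝ)

/-- The model with corners of the (`2n`-dimensional) manifold `T*M`. -/
abbrev cotangentModel :
    ModelWithCorners ℝ (Euc n × (Euc n →L[ℝ] ℝ)) (ModelProd (Euc n) (Euc n →L[ℝ] ℝ)) :=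
  (𝓡 n).prod 𝓘(ℝ, Euc n →L[ℝ] ℝ)

variable {n M}

/-- A time orientation of `(M, g)`: a continuous timelike vector field, which is declared to be
future pointing. -/
structure TimeOrientation (g : LorentzianMetric n M) where
  field : ∀ x : M, TangentSpace (𝓡 n) x
  continuous : Continuous fun x => (⟨x, field x⟩ : TangentBundle (𝓡 n) M)
  timelike : ∀ x, g.inner x (field x) (field x) < 0

/-- The tangent vector `v` is causal and lies in the same half of the causal cone as the time
orientation. -/
def TimeOrientation.IsFuturePointing {g : LorentzianMetric n M} (τ : TimeOrientation g) (x : M)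
    (v : TangentSpace (𝓡 n) x) : Prop :=
  g.inner x v v ≤ 0 ∧ g.inner x v (τ.field x) < 0

instance (x : M) : FiniteDimensional ℝ (TangentSpace (𝓡 n) x) :=
  inferInstanceAs (FiniteDimensional ℝ (Euc n))

namespace LorentzianMetric

variable (g : LorentzianMetric n M)

/-- The metric at `x`, as a bilinear form. -/
def bilin (x : M) : LinearMap.BilinForm ℝ (TangentSpace (𝓡 n) x) :=
  LinearMap.mk₂ ℝ (fun v w => g.inner x v w) (by simp) (by simp) (by simp) (by simp)

theorem bilin_nondegenerate (x : M) : (g.bilin x).Nondegenerate := by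
  have key : ∀ v : TangentSpace (𝓡 n) x, (∀ w, g.inner x v w = 0) → v = 0 := by
    intro v hv
    by_contra hne
    obtain ⟨t, ht⟩ := g.exists_timelike x
    have := g.pos_of_orthogonal x t v ht (by rw [g.symm]; exact hv t) hne
    exact absurd (hv v) this.ne'
  refine ⟨fun v hv => key v hv, fun v hv => key v fun w => ?_⟩
  rw [g.symm]
  exact hv w

/-- The vector `♯α` with `g(♯α, ·) = α`. -/
def sharp (x : M) (α : TangentSpace (𝓡 n) x →L[ℝ] ℝ) : TangentSpace (𝓡 n) x :=
  ((g.bilin x).toDual (g.bilin_nondegenerate x)).symm (α : TangentSpace (𝓡 n) x →ₗ[ℝ] ℝ)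

theorem inner_sharp (x : M) (α : TangentSpace (𝓡 n) x →L[ℝ] ℝ) :
    g.inner x (g.sharp x α) = α := by
  ext w
  exact LinearMap.BilinForm.apply_toDual_symm_apply (B := g.bilin x)
    (hB := g.bilin_nondegenerate x) (α : TangentSpace (𝓡 n) x →ₗ[ℝ] ℝ) w

/-- The dual metric `g*` on covectors, `g*(α, β) = g(♯α, ♯β)`. -/
def dualInner (x : M) (α β : TangentSpace (𝓡 n) x →L[ℝ] ℝ) : ℝ :=
  g.inner x (g.sharp x α) (g.sharp x β)

/-- The Hamiltonian `E_g(α) = g*(α, α)` on `T*M`. -/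
def energy (α : CotangentBundle n M) : ℝ := g.dualInner α.proj α.snd α.snd

end LorentzianMetric

/-- The canonical (Liouville) 1-form `θ` on `T*M`: `θ_α(W) = α(dπ W)` with `π : T*M → M`. -/
def liouvilleForm (α : CotangentBundle n M) : TangentSpace (cotangentModel n) α →L[ℝ] ℝ :=
  α.snd.comp (mfderiv (cotangentModel n) (𝓡 n)
    (TotalSpace.proj : CotangentBundle n M → M) α)

/-- The Euler vector field `ξ` on `T*M`: the velocity at `t = 1` of the curve `t ↦ t α`. -/
def eulerField (α : CotangentBundle n M) : TangentSpace (cotangentModel n) α :=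
  mfderiv 𝓘(ℝ, ℝ) (cotangentModel n)
    (fun t : ℝ => (⟨α.proj, t • α.snd⟩ : CotangentBundle n M)) 1 (1 : ℝ)

namespace LorentzianMetric

variable (g : LorentzianMetric n M)

/-- `X` is the symplectic gradient of `E_g` at `α` for the canonical symplectic form `-dθ`
(`= dq ∧ dp`) on `T*M`, i.e. `-dθ(X, W) = dE_g(W)` for all `W`. -/
def IsSymplecticGradient (α : CotangentBundle n M)
    (X : TangentSpace (cotangentModel n) α) : Prop :=
  ∀ W : TangentSpace (cotangentModel n) α,
    -oneFormExtDeriv (cotangentModel n) (liouvilleForm (n := n) (M := M)) α X W =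
      mfderiv (cotangentModel n) 𝓘(ℝ, ℝ) g.energy α W

/-- The generator `X_g` of the cogeodesic flow: the vector field on `T*M` whose value is the
symplectic gradient of `E_g` (which exists and is unique, as `dθ` is nondegenerate). -/
def cogeodesicField (α : CotangentBundle n M) : TangentSpace (cotangentModel n) α :=
  Classical.epsilon (g.IsSymplecticGradient α)

end LorentzianMetric

section NullGeodesics

variable (g : LorentzianMetric n M) (τ : TimeOrientation g)

/-- The future pointing dual null cones `L*M ⊆ T*M`. -/
def dualNullCone : Set (CotangentBundle n M) :=
  {α | g.dualInner α.proj α.snd α.snd = 0 ∧ α.snd ≠ 0 ∧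
    ∃ v : TangentSpace (𝓡 n) α.proj, τ.IsFuturePointing α.proj v ∧ α.snd = g.inner α.proj v}

/-- The tangent space of `L*M` at one of its points `α`, as a subspace of `T_α(T*M)`. Since `L*M` is
open in the set of nonzero covectors with `E_g = 0`, a regular level set of `E_g`, it is the kernel
of `dE_g`. -/
def dualNullConeTangent (α : CotangentBundle n M) :
    Submodule ℝ (TangentSpace (cotangentModel n) α) :=
  (mfderiv (cotangentModel n) 𝓘(ℝ, ℝ) g.energy α).ker

/-- The integrable distribution spanned by `X_g` and `ξ`. -/
def nullDistribution (α : CotangentBundle n M) : Submodule ℝ (TangentSpace (cotangentModel n) α) :=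
  Submodule.span ℝ {g.cogeodesicField α, eulerField α}

/-- `α` and `β` are joined by a smooth curve in `L*M` which is everywhere tangent to the
distribution spanned by `X_g` and `ξ`. -/
def JoinedByTangentCurve (α β : dualNullCone g τ) : Prop :=
  ∃ c : ℝ → CotangentBundle n M, ContMDiff 𝓘(ℝ, ℝ) (cotangentModel n) ∞ c ∧
    c 0 = α ∧ c 1 = β ∧ ∀ t : ℝ, c t ∈ dualNullCone g τ ∧
      mfderiv 𝓘(ℝ, ℝ) (cotangentModel n) c t (1 : ℝ) ∈ nullDistribution g (c t)

/-- Two points of `L*M` are equivalent if they lie on the same leaf of the foliation `F_null` of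
`L*M` tangent to the distribution spanned by `X_g` and `ξ`, i.e. if they are connected by a finite
chain of curves tangent to that distribution. -/
def leafSetoid : Setoid (dualNullCone g τ) := Relation.EqvGen.setoid (JoinedByTangentCurve g τ)

/-- The space of null geodesics `N_g`, the leaf space of `F_null`. -/
def NullGeodesicSpace : Type _ := Quotient (leafSetoid g τ)

/-- The quotient topology, where `L*M` has the subspace topology of `T*M`. -/
instance : TopologicalSpace (NullGeodesicSpace g τ) :=
  inferInstanceAs (TopologicalSpace (Quotient (leafSetoid g τ)))

/-- The projection `L*M → N_g`, sending a covector to its leaf. -/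
def toLeaf (α : dualNullCone g τ) : NullGeodesicSpace g τ := Quotient.mk (leafSetoid g τ) α

variable [ChartedSpace (Euc (2 * n - 3)) (NullGeodesicSpace g τ)]

/-- `F` extends the projection `L*M → N_g` to a smooth map on an open neighbourhood of `α` in
`T*M`. -/
def IsLocalExtension (α : dualNullCone g τ) (F : CotangentBundle n M → NullGeodesicSpace g τ) :
    Prop :=
  ∃ U : Set (CotangentBundle n M), IsOpen U ∧ (α : CotangentBundle n M) ∈ U ∧
    ContMDiffOn (cotangentModel n) (𝓡 (2 * n - 3)) ∞ F U ∧
    ∀ β : dualNullCone g τ, (β : CotangentBundle n M) ∈ U → F β = toLeaf g τ β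

/-- The smooth structure of `L*M` descends to the given smooth structure of `N_g`: the projection
`L*M → N_g` is a smooth submersion. A map on the embedded submanifold `L*M` of `T*M` is smooth if
it extends locally to smooth maps on open subsets of `T*M`, and its differential is the restriction
of the differential of such an extension to the tangent spaces of `L*M`. -/
def SmoothStructureDescends : Prop :=
  ∀ α : dualNullCone g τ, ∃ F : CotangentBundle n M → NullGeodesicSpace g τ,
    IsLocalExtension g τ α F ∧
    ∀ u : TangentSpace (𝓡 (2 * n - 3)) (F α), ∃ v ∈ dualNullConeTangent g (α : CotangentBundle n M),
      mfderiv (cotangentModel n) (𝓡 (2 * n - 3)) F (α : CotangentBundle n M) v = u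

/-- The field of tangent subspaces `D` on `N_g` is the one induced by `ker θ`: for every `α` in
`L*M`, the preimage of `D` under the differential `T_α(L*M) → T N_g` of the projection is
`ker θ ∩ T_α(L*M)`. -/
def IsInducedByLiouville
    (D : ∀ κ : NullGeodesicSpace g τ, Submodule ℝ (TangentSpace (𝓡 (2 * n - 3)) κ)) : Prop :=
  ∀ (α : dualNullCone g τ) (F : CotangentBundle n M → NullGeodesicSpace g τ),
    IsLocalExtension g τ α F → ∀ v ∈ dualNullConeTangent g (α : CotangentBundle n M),
      (mfderiv (cotangentModel n) (𝓡 (2 * n - 3)) F (α : CotangentBundle n M) v ∈ D (F α) ↔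
        liouvilleForm (α : CotangentBundle n M) v = 0)

end NullGeodesics

end Spacetime

end

/-! Put `ω = -dθ`. Three identities carry the theorem: `ω(X_g, ·) = dE_g` by definition, `ω(ξ, ·) =
-θ` because `θ` is linear on the fibres, and `dE_g(ξ) = 2 E_g` because `E_g` is quadratic on them.
They give `θ(ξ) = 0` and `θ(X_g) = 2 E_g`, so on the null cone `θ` vanishes on the leaf directions.
Since `dp` is onto and its kernel is spanned by `X_g` and `ξ` (by dimension), `ker θ` at a single
covector determines a subspace of the tangent space of the leaf space. This gives uniqueness.

For existence the subspace must not depend on the covector chosen in the leaf. For `V = a X_g + b ξ`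
the identities give `dθ(V, ·) = -a dE_g + b θ`, which is `b θ` on vectors tangent to the cone. Along
a curve in a leaf the induced covector on the fixed tangent space of the leaf space therefore
satisfies `m' = b m`. It moves on a ray, and its kernel is constant
(`eventually_kernel_iff_of_characteristic`, `leafKernel_eq_of_toLeaf_eq`).

For the contact condition take a smooth local section `s` of the projection and `η = s^*θ`. If `v ∈
D` and `dη(v, ·)` vanishes on `D`, then `ω(ds v, ·)` vanishes on `ker dE_g ∩ ker θ`, so it is a
combination of `dE_g` and `θ`. As `ω` is nondegenerate, `ds v` is a combination of `X_g` and `ξ`,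
and the projection sends it to `0`. Hence `v = 0`.

The null cone is never given a manifold structure. The projection is extended locally to a map `F`
on `T*M`, and the pair `(E_g, F)`, read in charts, is a submersion of `2n`-dimensional space onto `ℝ
× ℝ^(2n-3)` whose part over `{0}` is the projection. -/

noncomputable section

set_option linter.unusedSectionVars false

/-! ### Differentials as maps of model spaces, and charts. -/

section TangentMap

variable {E H M : Type*} [NormedAddCommGroup E] [NormedSpace ℝ E] [TopologicalSpace H]
  [TopologicalSpace M] [ChartedSpace H M] (I : ModelWithCorners ℝ E H)
  {E' H' M' : Type*} [NormedAddCommGroup E'] [NormedSpace ℝ E'] [TopologicalSpace H']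
  [TopologicalSpace M'] [ChartedSpace H' M'] (I' : ModelWithCorners ℝ E' H')
  {E'' H'' M'' : Type*} [NormedAddCommGroup E''] [NormedSpace ℝ E''] [TopologicalSpace H'']
  [TopologicalSpace M''] [ChartedSpace H'' M''] (I'' : ModelWithCorners ℝ E'' H'')

/-- The manifold derivative, as a map between the model vector spaces. -/
def tanMap (f : M → M') (x : M) : E →L[ℝ] E' := mfderiv I I' f x

variable {I I' I''}

theorem tanMap_comp {g : M' → M''} {f : M → M'} {x : M} (hg : MDifferentiableAt I' I'' g (f x))
    (hf : MDifferentiableAt I I' f x) :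
    tanMap I I'' (fun z => g (f z)) x = (tanMap I' I'' g (f x)).comp (tanMap I I' f x) :=
  mfderiv_comp x hg hf

theorem Filter.EventuallyEq.tanMap_eq {f g : M → M'} {x : M} (h : f =ᶠ[𝓝 x] g) :
    tanMap I I' f x = tanMap I I' g x := by
  have h1 := h.mfderiv_eq (I := I) (I' := I')
  ext v
  exact DFunLike.congr_fun h1 v

theorem tanMap_eq_fderiv (f : E → E') (x : E) :
    tanMap 𝓘(ℝ, E) 𝓘(ℝ, E') f x = fderiv ℝ f x :=
  mfderiv_eq_fderiv

theorem tanMap_id (x : M) : tanMap I I (fun z : M => z) x = ContinuousLinearMap.id ℝ E :=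
  mfderiv_id

theorem tanMap_const (x : M) (c : M') : tanMap I I' (fun _ : M => c) x = 0 :=
  mfderiv_const

theorem tanMap_extChartAt_self [IsManifold I 1 M] (x : M) :
    tanMap I 𝓘(ℝ, E) (extChartAt I x) x = ContinuousLinearMap.id ℝ E :=
  mfderiv_extChartAt_self

theorem tanMap_extChartAt_symm_self [I.Boundaryless] [IsManifold I 1 M] (x : M) :
    tanMap 𝓘(ℝ, E) I (extChartAt I x).symm (extChartAt I x x) = ContinuousLinearMap.id ℝ E := by
  have := mfderivWithin_range_extChartAt_symm (I := I) (x := x)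
  rw [I.range_eq_univ, mfderivWithin_univ] at this
  exact this

theorem extChartAt_target_mem_nhds_of_mem [I.Boundaryless]
    {x : M} {y : E} (hy : y ∈ (extChartAt I x).target) : (extChartAt I x).target ∈ 𝓝 y :=
  (isOpen_extChartAt_target x).mem_nhds hy

theorem contMDiffAt_extChartAt_symm [I.Boundaryless]
    {k : WithTop ℕ∞} [IsManifold I k M] {x : M} {y : E} (hy : y ∈ (extChartAt I x).target) :
    ContMDiffAt 𝓘(ℝ, E) I k (extChartAt I x).symm y :=
  (contMDiffOn_extChartAt_symm x).contMDiffAt (extChartAt_target_mem_nhds_of_mem hy)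

theorem mdifferentiableAt_extChartAt_symm [I.Boundaryless]
    [IsManifold I 1 M] {x : M} {y : E} (hy : y ∈ (extChartAt I x).target) :
    MDifferentiableAt 𝓘(ℝ, E) I (extChartAt I x).symm y :=
  (contMDiffAt_extChartAt_symm (k := 1) hy).mdifferentiableAt one_ne_zero

theorem mdifferentiableAt_extChartAt_of_mem_source
    [IsManifold I 1 M] {x y : M} (hy : y ∈ (extChartAt I x).source) :
    MDifferentiableAt I 𝓘(ℝ, E) (extChartAt I x) y :=
  mdifferentiableAt_extChartAt (by simpa using hy)

theorem tanMap_extChartAt_tanMap_symm [I.Boundaryless]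
    [IsManifold I 1 M] {x : M} {y : E} (hy : y ∈ (extChartAt I x).target) (v : E) :
    tanMap I 𝓘(ℝ, E) (extChartAt I x) ((extChartAt I x).symm y)
      (tanMap 𝓘(ℝ, E) I (extChartAt I x).symm y v) = v := by
  have := mfderiv_extChartAt_comp_mfderivWithin_extChartAt_symm (I := I) hy
  rw [I.range_eq_univ, mfderivWithin_univ] at this
  exact DFunLike.congr_fun this v

theorem tanMap_symm_tanMap_extChartAt [I.Boundaryless]
    [IsManifold I 1 M] {x : M} {y : E} (hy : y ∈ (extChartAt I x).target) (v : E) :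
    tanMap 𝓘(ℝ, E) I (extChartAt I x).symm y
      (tanMap I 𝓘(ℝ, E) (extChartAt I x) ((extChartAt I x).symm y) v) = v := by
  have := mfderivWithin_extChartAt_symm_comp_mfderiv_extChartAt (I := I) hy
  rw [I.range_eq_univ, mfderivWithin_univ] at this
  exact DFunLike.congr_fun this v

theorem ContMDiffAt.eventually_mdifferentiableAt [IsManifold I 1 M] [IsManifold I' 1 M']
    {f : M → M'} {x : M} (hf : ContMDiffAt I I' 1 f x) :
    ∀ᶠ z in 𝓝 x, MDifferentiableAt I I' f z := by
  have h := (contMDiffAt_iff_contMDiffAt_nhds (n := 1) (by simp)).1 hf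
  filter_upwards [h] with z hz using hz.mdifferentiableAt one_ne_zero

end TangentMap

/-! ### Naturality of the exterior derivative of a 1-form. -/

section Forms

variable {E H N : Type*} [NormedAddCommGroup E] [NormedSpace ℝ E] [TopologicalSpace H]
  [TopologicalSpace N] [ChartedSpace H N] (I : ModelWithCorners ℝ E H) [I.Boundaryless]

/-- The coordinate expression of a 1-form given by covectors on the model vector space. -/
def formInChart (η : N → E →L[ℝ] ℝ) (x : N) (y : E) : E →L[ℝ] ℝ := oneFormInChart I η x y

/-- The exterior derivative of a 1-form given by covectors on the model vector space. -/
def formDeriv (η : N → E →L[ℝ] ℝ) (x : N) (v w : E) : ℝ := oneFormExtDeriv I η x v w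

theorem formInChart_apply (η : N → E →L[ℝ] ℝ) (x : N) (y v : E) :
    formInChart I η x y v =
      η ((extChartAt I x).symm y) (tanMap 𝓘(ℝ, E) I (extChartAt I x).symm y v) := rfl

/-- Tangent spaces are identified with the model space in such a way that the preferred chart at `x`
has the identity as its differential at `x`, so the chart differentials in the definition disappear.
-/
theorem formDeriv_eq [IsManifold I 1 N] (η : N → E →L[ℝ] ℝ) (x : N) (v w : E) :
    formDeriv I η x v w =
      fderiv ℝ (formInChart I η x) (extChartAt I x x) v w -
        fderiv ℝ (formInChart I η x) (extChartAt I x x) w v := by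
  have h : ∀ v : E, tanMap I 𝓘(ℝ, E) (extChartAt I x) x v = v := by
    intro v
    rw [tanMap_extChartAt_self, ContinuousLinearMap.id_apply]
  change oneFormExtDeriv I η x v w = _
  calc oneFormExtDeriv I η x v w = fderiv ℝ (formInChart I η x) (extChartAt I x x)
        (tanMap I 𝓘(ℝ, E) (extChartAt I x) x v) (tanMap I 𝓘(ℝ, E) (extChartAt I x) x w) -
        fderiv ℝ (formInChart I η x) (extChartAt I x x)
        (tanMap I 𝓘(ℝ, E) (extChartAt I x) x w) (tanMap I 𝓘(ℝ, E) (extChartAt I x) x v) := rfl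
    _ = _ := by rw [h, h]

/-- The exterior derivative of a 1-form is natural under pullback by maps from a vector space. -/
theorem formDeriv_pullback {P : Type*} [NormedAddCommGroup P] [NormedSpace ℝ P]
    [IsManifold I 2 N] (η : N → E →L[ℝ] ℝ) (f : P → N) (y : P)
    (hf : ContMDiffAt 𝓘(ℝ, P) I 2 f y)
    (hη : DifferentiableAt ℝ (formInChart I η (f y)) (extChartAt I (f y) (f y)))
    (Ω : P → P →L[ℝ] ℝ)
    (hΩ : ∀ᶠ z in 𝓝 y, Ω z = (η (f z)).comp (tanMap 𝓘(ℝ, P) I f z)) (v w : P) :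
    fderiv ℝ Ω y v w - fderiv ℝ Ω y w v =
      formDeriv I η (f y) (tanMap 𝓘(ℝ, P) I f y v) (tanMap 𝓘(ℝ, P) I f y w) := by
  have : IsManifold I 1 N := IsManifold.of_le (n := 2) (by norm_num)
  set φ := extChartAt I (f y) with hφ
  set F : P → E := fun z => φ (f z) with hF
  have hFs : ContDiffAt ℝ 2 F y := by
    rw [← contMDiffAt_iff_contDiffAt]
    exact (contMDiffAt_extChartAt (x := f y)).comp y hf
  have hsrc : ∀ᶠ z in 𝓝 y, f z ∈ φ.source :=
    hf.continuousAt.eventually ((isOpen_extChartAt_source (I := I) (f y)).mem_nhds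
      (mem_extChartAt_source (f y)))
  have hfd : ∀ᶠ z in 𝓝 y, MDifferentiableAt 𝓘(ℝ, P) I f z :=
    (hf.of_le (by norm_num : (1 : WithTop ℕ∞) ≤ 2)).eventually_mdifferentiableAt
  have hFd : ∀ᶠ z in 𝓝 y, DifferentiableAt ℝ F z := by
    filter_upwards [hFs.eventually (by simp)] with z hz
    exact hz.differentiableAt two_ne_zero
  have hFf : ∀ᶠ z in 𝓝 y, tanMap 𝓘(ℝ, P) I f z =
      (tanMap 𝓘(ℝ, E) I φ.symm (F z)).comp (fderiv ℝ F z) := by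
    filter_upwards [hsrc.eventually_nhds, hFd] with z hz hz2
    have h1 : f =ᶠ[𝓝 z] fun u => φ.symm (F u) := by
      filter_upwards [hz] with u hu
      exact (φ.left_inv hu).symm
    have ht : F z ∈ φ.target := φ.map_source hz.self_of_nhds
    rw [h1.tanMap_eq, tanMap_comp (mdifferentiableAt_extChartAt_symm ht) hz2.mdifferentiableAt,
      tanMap_eq_fderiv]
  have hΩ' : Ω =ᶠ[𝓝 y] fun z => (formInChart I η (f y) (F z)).comp (fderiv ℝ F z) := by
    filter_upwards [hΩ, hFf, hsrc] with z h1 h2 h3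
    ext v
    rw [h1, h2, ContinuousLinearMap.comp_apply, ContinuousLinearMap.comp_apply,
      ContinuousLinearMap.comp_apply, formInChart_apply, ← hφ, φ.left_inv h3]
  have hd2 : DifferentiableAt ℝ (fderiv ℝ F) y :=
    (hFs.fderiv_right (m := 1) (by norm_num)).differentiableAt one_ne_zero
  have hder := (hη.hasFDerivAt.comp y (hFd.self_of_nhds).hasFDerivAt).clm_comp hd2.hasFDerivAt
  -- The part of the derivative of `Ω` containing the second derivative of `F` is symmetric, so it
  -- drops out after antisymmetrisation.
  have hsymm := hFs.isSymmSndFDerivAt (by simp)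
  have e : fderiv ℝ Ω y = _ := hΩ'.fderiv_eq.trans hder.fderiv
  have hm : tanMap 𝓘(ℝ, P) I f y = fderiv ℝ F y := by
    rw [← tanMap_eq_fderiv, hF, tanMap_comp
      (mdifferentiableAt_extChartAt_of_mem_source (mem_extChartAt_source (f y)))
      hfd.self_of_nhds, tanMap_extChartAt_self, ContinuousLinearMap.id_comp]
  rw [formDeriv_eq, hm, e]
  have := hsymm.eq v w
  simp only [add_apply, ContinuousLinearMap.comp_apply,
    ContinuousLinearMap.compL_apply, ContinuousLinearMap.flip_apply, this]
  abel

end Forms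

/-- The model vector space of `T*M`. -/
abbrev Phase (n : ℕ) : Type := Euc n × (Euc n →L[ℝ] ℝ)

/-! ### The model space of `T*M` and its dual. -/

section Instances

variable {n : ℕ}

instance : NormedAddCommGroup (Euc n →L[ℝ] ℝ) := inferInstance
instance : SeminormedAddCommGroup (Euc n →L[ℝ] ℝ) := inferInstance
instance : AddCommGroup (Euc n →L[ℝ] ℝ) := inferInstance
instance : AddCommMonoid (Euc n →L[ℝ] ℝ) := inferInstance
instance : TopologicalSpace (Euc n →L[ℝ] ℝ) := inferInstance
instance : NormedSpace ℝ (Euc n →L[ℝ] ℝ) := inferInstance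
instance : Module ℝ (Euc n →L[ℝ] ℝ) := inferInstance
instance : T2Space (Euc n →L[ℝ] ℝ) := inferInstance
instance : IsTopologicalAddGroup (Euc n →L[ℝ] ℝ) := inferInstance
instance : ContinuousSMul ℝ (Euc n →L[ℝ] ℝ) := inferInstance

instance : NormedAddCommGroup (Phase n) := inferInstance
instance : SeminormedAddCommGroup (Phase n) := inferInstance
instance : AddCommGroup (Phase n) := inferInstance
instance : AddCommMonoid (Phase n) := inferInstance
instance : TopologicalSpace (Phase n) := inferInstance
instance : NormedSpace ℝ (Phase n) := inferInstance
instance : Module ℝ (Phase n) := inferInstance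
instance : T2Space (Phase n) := inferInstance
instance : ContinuousSMul ℝ (Phase n) := inferInstance

instance : NormedAddCommGroup (Phase n →L[ℝ] ℝ) := inferInstance
instance : SeminormedAddCommGroup (Phase n →L[ℝ] ℝ) := inferInstance
instance : AddCommGroup (Phase n →L[ℝ] ℝ) := inferInstance
instance : AddCommMonoid (Phase n →L[ℝ] ℝ) := inferInstance
instance : TopologicalSpace (Phase n →L[ℝ] ℝ) := inferInstance
instance : NormedSpace ℝ (Phase n →L[ℝ] ℝ) := inferInstance
instance : Module ℝ (Phase n →L[ℝ] ℝ) := inferInstance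
instance : T2Space (Phase n →L[ℝ] ℝ) := inferInstance
instance : IsTopologicalAddGroup (Phase n →L[ℝ] ℝ) := inferInstance
instance : ContinuousSMul ℝ (Phase n →L[ℝ] ℝ) := inferInstance

end Instances

/-! ### Canonical coordinates on `T*M`; the Liouville form and the Euler field in them. -/

section Cotangent

variable {n : ℕ} {M : Type*} [TopologicalSpace M] [ChartedSpace (Euc n) M]

/-- The covector at `x` with components `p` in the tangent space identified with `ℝⁿ`. -/
def mkCov (x : M) (p : Euc n →L[ℝ] ℝ) : CotangentBundle n M := ⟨x, p⟩

/-- The covector part of a point of `T*M`. -/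
def cov (α : CotangentBundle n M) : Euc n →L[ℝ] ℝ := α.snd

@[simp] theorem mkCov_proj (x : M) (p : Euc n →L[ℝ] ℝ) : (mkCov x p).proj = x := rfl
@[simp] theorem cov_mkCov (x : M) (p : Euc n →L[ℝ] ℝ) : cov (mkCov x p) = p := rfl

variable [IsManifold (𝓡 n) ∞ M]

theorem cotangent_extChartAt_source (α : CotangentBundle n M) :
    (extChartAt (cotangentModel n) α).source =
      TotalSpace.proj ⁻¹' (extChartAt (𝓡 n) α.proj).source := by
  rw [FiberBundle.extChartAt]
  ext β
  rw [PartialEquiv.trans_source, PartialEquiv.prod_source, PartialEquiv.refl_source]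
  have : ((trivializationAt (Euc n →L[ℝ] ℝ) (fun x => TangentSpace (𝓡 n) x →L[ℝ] ℝ) α.proj) β).1 =
      β.proj := rfl
  simp [this]

/-- The trivialization of a bundle of linear maps precomposes with the inverse tangent
trivialization, which is the differential of the inverse chart. So the charts of `T*M` are the
classical coordinates `(q, p)` induced by charts of `M`. -/
theorem cotangent_extChartAt_apply (α β : CotangentBundle n M)
    (h : β.proj ∈ (extChartAt (𝓡 n) α.proj).source) :
    extChartAt (cotangentModel n) α β = (extChartAt (𝓡 n) α.proj β.proj,
      (cov β).comp (tanMap 𝓘(ℝ, Euc n) (𝓡 n) (extChartAt (𝓡 n) α.proj).symm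
        (extChartAt (𝓡 n) α.proj β.proj))) := by
  rw [FiberBundle.extChartAt]
  have h' : β.proj ∈ (chartAt (Euc n) α.proj).source := by simpa using h
  have h1 := TangentBundle.symmL_trivializationAt (I := 𝓡 n) h'
  rw [ModelWithCorners.range_eq_univ, mfderivWithin_univ] at h1
  refine Prod.ext rfl ?_
  ext v
  change (ContinuousLinearMap.inCoordinates (Euc n) (TangentSpace (𝓡 n)) ℝ (fun _ : M => ℝ) α.proj
    β.proj α.proj β.proj β.snd) v = _
  simp only [ContinuousLinearMap.inCoordinates, h1]
  simp
  rfl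

theorem cotangent_extChartAt_target (α : CotangentBundle n M) :
    (extChartAt (cotangentModel n) α).target = (extChartAt (𝓡 n) α.proj).target ×ˢ Set.univ := by
  rw [FiberBundle.extChartAt_target]
  congr 1
  ext y
  simp only [Set.mem_inter_iff, and_iff_left_iff_imp]
  intro hy
  have := (extChartAt (𝓡 n) α.proj).map_target hy
  simpa using this

theorem cotangent_extChartAt_symm (α : CotangentBundle n M) {y : Phase n}
    (hy : y ∈ (extChartAt (cotangentModel n) α).target) :
    (extChartAt (cotangentModel n) α).symm y = mkCov ((extChartAt (𝓡 n) α.proj).symm y.1)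
      (y.2.comp (tanMap (𝓡 n) 𝓘(ℝ, Euc n) (extChartAt (𝓡 n) α.proj)
        ((extChartAt (𝓡 n) α.proj).symm y.1))) := by
  rw [cotangent_extChartAt_target] at hy
  have h1 := (extChartAt (𝓡 n) α.proj).map_target hy.1
  have h2 : extChartAt (cotangentModel n) α (mkCov ((extChartAt (𝓡 n) α.proj).symm y.1)
      (y.2.comp (tanMap (𝓡 n) 𝓘(ℝ, Euc n) (extChartAt (𝓡 n) α.proj)
        ((extChartAt (𝓡 n) α.proj).symm y.1)))) = y := by
    rw [cotangent_extChartAt_apply _ _ h1]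
    refine Prod.ext ((extChartAt (𝓡 n) α.proj).right_inv hy.1) ?_
    ext v
    simp only [cov_mkCov, mkCov_proj, ContinuousLinearMap.comp_apply]
    rw [(extChartAt (𝓡 n) α.proj).right_inv hy.1, tanMap_extChartAt_tanMap_symm hy.1]
  conv_lhs => rw [← h2]
  apply (extChartAt (cotangentModel n) α).left_inv
  rw [cotangent_extChartAt_source]
  exact h1

theorem cotangent_mdifferentiableAt_proj (α : CotangentBundle n M) :
    MDifferentiableAt (cotangentModel n) (𝓡 n) (TotalSpace.proj : CotangentBundle n M → M) α :=
  (contMDiff_proj (n := 1) _ α).mdifferentiableAt one_ne_zero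

/-- The canonical 1-form, on the model vector space. -/
def liouville (α : CotangentBundle n M) : Phase n →L[ℝ] ℝ := liouvilleForm α

theorem liouville_apply (α : CotangentBundle n M) (v : Phase n) :
    liouville α v = cov α (tanMap (cotangentModel n) (𝓡 n) TotalSpace.proj α v) := rfl

/-- This is `θ = p dq`: in these coordinates the bundle projection is the first projection, and the
chart differentials in the covector and in the tangent vector cancel. -/
theorem liouville_tanMap_symm (α : CotangentBundle n M) {y : Phase n}
    (hy : y ∈ (extChartAt (cotangentModel n) α).target) (v : Phase n) :
    liouville ((extChartAt (cotangentModel n) α).symm y)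
      (tanMap 𝓘(ℝ, Phase n) (cotangentModel n) (extChartAt (cotangentModel n) α).symm y v) =
        y.2 v.1 := by
  have hy' := hy
  rw [cotangent_extChartAt_target] at hy'
  have h1 : (fun z : Phase n => ((extChartAt (cotangentModel n) α).symm z).proj) =ᶠ[𝓝 y]
      fun z => (extChartAt (𝓡 n) α.proj).symm z.1 := by
    filter_upwards [extChartAt_target_mem_nhds_of_mem hy] with z hz
    rw [cotangent_extChartAt_symm α hz, mkCov_proj]
  have h2 := h1.tanMap_eq (I := 𝓘(ℝ, Phase n)) (I' := 𝓡 n)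
  have h3 : MDifferentiableAt 𝓘(ℝ, Euc n) (𝓡 n) (extChartAt (𝓡 n) α.proj).symm y.1 :=
    mdifferentiableAt_extChartAt_symm hy'.1
  rw [tanMap_comp (cotangent_mdifferentiableAt_proj _) (mdifferentiableAt_extChartAt_symm hy),
    tanMap_comp h3 differentiableAt_fst.mdifferentiableAt, tanMap_eq_fderiv] at h2
  rw [liouville_apply]
  refine (congrArg _ (DFunLike.congr_fun h2 v)).trans ?_
  rw [cotangent_extChartAt_symm α hy]
  simp only [cov_mkCov, ContinuousLinearMap.comp_apply, fderiv_fst, ContinuousLinearMap.coe_fst']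
  rw [tanMap_extChartAt_tanMap_symm hy'.1]

/-- The canonical 1-form `p dq` on the model vector space, as a linear map of the base point. -/
def canonicalOneForm (n : ℕ) : Phase n →L[ℝ] Phase n →L[ℝ] ℝ :=
  ((ContinuousLinearMap.compL ℝ (Phase n) (Euc n) ℝ).flip
    (ContinuousLinearMap.fst ℝ (Euc n) (Euc n →L[ℝ] ℝ))).comp
    (ContinuousLinearMap.snd ℝ (Euc n) (Euc n →L[ℝ] ℝ))

@[simp] theorem canonicalOneForm_apply (y v : Phase n) : canonicalOneForm n y v = y.2 v.1 := rfl

theorem formInChart_liouville (α : CotangentBundle n M) {y : Phase n}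
    (hy : y ∈ (extChartAt (cotangentModel n) α).target) :
    formInChart (cotangentModel n) (liouville (n := n) (M := M)) α y = canonicalOneForm n y := by
  refine ContinuousLinearMap.ext fun v => ?_
  rw [formInChart_apply, liouville_tanMap_symm α hy]
  rfl

theorem formInChart_liouville_eventuallyEq (α : CotangentBundle n M) {y : Phase n}
    (hy : y ∈ (extChartAt (cotangentModel n) α).target) :
    formInChart (cotangentModel n) (liouville (n := n) (M := M)) α =ᶠ[𝓝 y] canonicalOneForm n := by
  filter_upwards [extChartAt_target_mem_nhds_of_mem hy] with y hy
  exact formInChart_liouville α hy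

/-- The formula `dθ = dp ∧ dq` holds at every `α` in its own tangent space, since the canonical
chart at `α` has identity differential there. -/
theorem formDeriv_liouville (α : CotangentBundle n M) (v w : Phase n) :
    formDeriv (cotangentModel n) (liouville (n := n) (M := M)) α v w = v.2 w.1 - w.2 v.1 := by
  rw [formDeriv_eq, (formInChart_liouville_eventuallyEq α (mem_extChartAt_target α)).fderiv_eq,
    (canonicalOneForm n).hasFDerivAt.fderiv]
  rfl

theorem differentiableAt_formInChart_liouville (α : CotangentBundle n M) :
    DifferentiableAt ℝ (formInChart (cotangentModel n) (liouville (n := n) (M := M)) α)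
      (extChartAt (cotangentModel n) α α) :=
  (canonicalOneForm n).differentiableAt.congr_of_eventuallyEq
    (formInChart_liouville_eventuallyEq α (mem_extChartAt_target α))

/-- The symplectic form `dθ` in the coordinates of a chart. -/
theorem formDeriv_liouville_tanMap_symm (α : CotangentBundle n M) {y : Phase n}
    (hy : y ∈ (extChartAt (cotangentModel n) α).target) (v w : Phase n) :
    formDeriv (cotangentModel n) (liouville (n := n) (M := M))
      ((extChartAt (cotangentModel n) α).symm y)
      (tanMap 𝓘(ℝ, Phase n) (cotangentModel n) (extChartAt (cotangentModel n) α).symm y v)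
      (tanMap 𝓘(ℝ, Phase n) (cotangentModel n) (extChartAt (cotangentModel n) α).symm y w) =
        v.2 w.1 - w.2 v.1 := by
  have h := formDeriv_pullback (cotangentModel n) (liouville (n := n) (M := M))
    (extChartAt (cotangentModel n) α).symm y (contMDiffAt_extChartAt_symm hy)
    (differentiableAt_formInChart_liouville _) (canonicalOneForm n) (by
      filter_upwards [extChartAt_target_mem_nhds_of_mem hy] with z hz
      exact (formInChart_liouville α hz).symm) v w
  rw [← h, (canonicalOneForm n).hasFDerivAt.fderiv]
  rfl

/-- The Euler vector field, on the model vector space. -/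
def euler (α : CotangentBundle n M) : Phase n := eulerField α

theorem euler_eq (α : CotangentBundle n M) : euler α = tanMap 𝓘(ℝ, ℝ) (cotangentModel n)
    (fun t : ℝ => mkCov α.proj (t • cov α)) 1 1 := rfl

theorem mkCov_smul_symm (α : CotangentBundle n M) {y : Phase n}
    (hy : y ∈ (extChartAt (cotangentModel n) α).target) (t : ℝ) :
    mkCov ((extChartAt (cotangentModel n) α).symm y).proj
      (t • cov ((extChartAt (cotangentModel n) α).symm y)) =
        (extChartAt (cotangentModel n) α).symm (y.1, t • y.2) := by
  have hy2 : (y.1, t • y.2) ∈ (extChartAt (cotangentModel n) α).target := by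
    rw [cotangent_extChartAt_target] at hy ⊢
    exact ⟨hy.1, trivial⟩
  rw [cotangent_extChartAt_symm α hy, cotangent_extChartAt_symm α hy2]
  rfl

/-- Canonical charts are linear on the fibres, so `t ↦ t α` becomes `t ↦ (q, t p)`. -/
theorem euler_symm (α : CotangentBundle n M) {y : Phase n}
    (hy : y ∈ (extChartAt (cotangentModel n) α).target) :
    euler ((extChartAt (cotangentModel n) α).symm y) =
      tanMap 𝓘(ℝ, Phase n) (cotangentModel n) (extChartAt (cotangentModel n) α).symm y
        (0, y.2) := by
  have h1 : (fun t : ℝ => mkCov ((extChartAt (cotangentModel n) α).symm y).proj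
      (t • cov ((extChartAt (cotangentModel n) α).symm y))) = fun t =>
        (extChartAt (cotangentModel n) α).symm (y.1, t • y.2) :=
    funext fun t => mkCov_smul_symm α hy t
  have h2 : HasDerivAt (fun t : ℝ => ((y.1, t • y.2) : Phase n)) (0, y.2) 1 := by
    simpa using (hasDerivAt_const (1 : ℝ) y.1).prodMk ((hasDerivAt_id (1 : ℝ)).smul_const y.2)
  have h3 : ((y.1, (1 : ℝ) • y.2) : Phase n) = y := by simp
  have h4 : MDifferentiableAt 𝓘(ℝ, Phase n) (cotangentModel n)
      (extChartAt (cotangentModel n) α).symm (y.1, (1 : ℝ) • y.2) := by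
    rw [h3]; exact mdifferentiableAt_extChartAt_symm hy
  rw [euler_eq, h1, tanMap_comp (f := fun t : ℝ => ((y.1, t • y.2) : Phase n)) h4
    h2.differentiableAt.mdifferentiableAt, tanMap_eq_fderiv, ContinuousLinearMap.comp_apply, h3,
    h2.hasFDerivAt.fderiv]
  simp

end Cotangent

/-! ### Nondegenerate bilinear forms in finite dimension. -/

section Bilinear

variable {V : Type*} [NormedAddCommGroup V] [NormedSpace ℝ V] [FiniteDimensional ℝ V]

theorem finrank_continuousDual : Module.finrank ℝ (V →L[ℝ] ℝ) = Module.finrank ℝ V := by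
  rw [← (LinearMap.toContinuousLinearMap (𝕜 := ℝ) (E := V) (F' := ℝ)).finrank_eq]
  exact Subspace.dual_finrank_eq

/-- A nondegenerate bilinear form on a finite dimensional space is an isomorphism to the dual. -/
theorem ContinuousLinearMap.isInvertible_of_nondegenerate (B : V →L[ℝ] V →L[ℝ] ℝ)
    (h : ∀ v, (∀ w, B v w = 0) → v = 0) : B.IsInvertible := by
  have hinj : Function.Injective (B : V →ₗ[ℝ] V →L[ℝ] ℝ) :=
    (injective_iff_map_eq_zero (B : V →ₗ[ℝ] V →L[ℝ] ℝ)).2 fun v hv => h v fun w => by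
      have : B v = 0 := hv
      simp [this]
  have hbij : Function.Bijective (B : V →ₗ[ℝ] V →L[ℝ] ℝ) :=
    ⟨hinj, (LinearMap.injective_iff_surjective_of_finrank_eq_finrank
      finrank_continuousDual.symm).1 hinj⟩
  exact ⟨(LinearEquiv.ofBijective (B : V →ₗ[ℝ] V →L[ℝ] ℝ) hbij).toContinuousLinearEquiv, by
    ext v w; rfl⟩

end Bilinear

/-! ### Smoothness and fibre derivative of the energy. -/

section Energy

variable {n : ℕ} {M : Type*} [TopologicalSpace M] [ChartedSpace (Euc n) M]
  [IsManifold (𝓡 n) ∞ M] (g : LorentzianMetric n M)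

namespace LorentzianMetric

/-- The metric at a point, on the model vector space. -/
def form (x : M) : Euc n →L[ℝ] Euc n →L[ℝ] ℝ := g.inner x

/-- The vector dual to a covector, on the model vector space. -/
def raise (x : M) (p : Euc n →L[ℝ] ℝ) : Euc n := g.sharp x p

theorem form_symm (x : M) (v w : Euc n) : g.form x v w = g.form x w v := g.symm x v w

theorem form_raise (x : M) (p : Euc n →L[ℝ] ℝ) : g.form x (g.raise x p) = p := g.inner_sharp x p

theorem eq_zero_of_form_eq_zero (x : M) (v : Euc n) (h : ∀ w, g.form x v w = 0) : v = 0 :=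
  (g.bilin_nondegenerate x).1 v h

theorem energy_eq (α : CotangentBundle n M) :
    g.energy α = cov α (g.raise α.proj (cov α)) := by
  change g.form α.proj (g.raise α.proj (cov α)) (g.raise α.proj (cov α)) = _
  rw [form_raise]

/-- The metric in the chart at `x₀`. -/
def formInChart (x₀ : M) (q : Euc n) : Euc n →L[ℝ] Euc n →L[ℝ] ℝ :=
  (g.form ((extChartAt (𝓡 n) x₀).symm q)).bilinearComp
    (tanMap 𝓘(ℝ, Euc n) (𝓡 n) (extChartAt (𝓡 n) x₀).symm q)
    (tanMap 𝓘(ℝ, Euc n) (𝓡 n) (extChartAt (𝓡 n) x₀).symm q)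

theorem formInChart_apply (x₀ : M) (q v w : Euc n) : g.formInChart x₀ q v w =
    g.form ((extChartAt (𝓡 n) x₀).symm q)
    (tanMap 𝓘(ℝ, Euc n) (𝓡 n) (extChartAt (𝓡 n) x₀).symm q v)
    (tanMap 𝓘(ℝ, Euc n) (𝓡 n) (extChartAt (𝓡 n) x₀).symm q w) := rfl

theorem formInChart_symm (x₀ : M) (q v w : Euc n) :
    g.formInChart x₀ q v w = g.formInChart x₀ q w v := by
  rw [formInChart_apply, formInChart_apply, form_symm]

theorem formInChart_isInvertible (x₀ : M) {q : Euc n} (hq : q ∈ (extChartAt (𝓡 n) x₀).target) :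
    (g.formInChart x₀ q).IsInvertible := by
  apply ContinuousLinearMap.isInvertible_of_nondegenerate
  intro v hv
  have h : tanMap 𝓘(ℝ, Euc n) (𝓡 n) (extChartAt (𝓡 n) x₀).symm q v = 0 := by
    apply g.eq_zero_of_form_eq_zero ((extChartAt (𝓡 n) x₀).symm q)
    intro w
    have := hv (tanMap (𝓡 n) 𝓘(ℝ, Euc n) (extChartAt (𝓡 n) x₀) ((extChartAt (𝓡 n) x₀).symm q) w)
    rwa [formInChart_apply, tanMap_symm_tanMap_extChartAt hq] at this
  rw [← tanMap_extChartAt_tanMap_symm (I := 𝓡 n) hq v, h, map_zero]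

theorem formInChart_tanMap (x₀ : M) {q : Euc n} (hq : q ∈ (extChartAt (𝓡 n) x₀).target)
    (p : Euc n →L[ℝ] ℝ) :
    g.formInChart x₀ q (tanMap (𝓡 n) 𝓘(ℝ, Euc n) (extChartAt (𝓡 n) x₀)
      ((extChartAt (𝓡 n) x₀).symm q) (g.raise ((extChartAt (𝓡 n) x₀).symm q)
        (p.comp (tanMap (𝓡 n) 𝓘(ℝ, Euc n) (extChartAt (𝓡 n) x₀)
          ((extChartAt (𝓡 n) x₀).symm q))))) = p := by
  ext w
  rw [formInChart_apply, tanMap_symm_tanMap_extChartAt hq, form_raise,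
    ContinuousLinearMap.comp_apply, tanMap_extChartAt_tanMap_symm hq]

/-- Raising an index commutes with passing to coordinates (`formInChart_tanMap`), so the energy
becomes the quadratic form of the inverse of the metric, an expression whose smoothness is visible.
-/
theorem energy_symm (α : CotangentBundle n M) {y : Phase n}
    (hy : y ∈ (extChartAt (cotangentModel n) α).target) :
    g.energy ((extChartAt (cotangentModel n) α).symm y) =
      y.2 ((g.formInChart α.proj y.1).inverse y.2) := by
  have hq : y.1 ∈ (extChartAt (𝓡 n) α.proj).target := by
    rw [cotangent_extChartAt_target] at hy; exact hy.1
  obtain ⟨L, hL⟩ := g.formInChart_isInvertible α.proj hq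
  have h2 := g.formInChart_tanMap α.proj hq y.2
  rw [energy_eq, cotangent_extChartAt_symm α hy]
  simp only [cov_mkCov, mkCov_proj, ContinuousLinearMap.comp_apply]
  congr 1
  rw [← hL] at h2
  rw [← hL, ContinuousLinearMap.inverse_equiv]
  exact (L.symm_apply_eq.2 h2.symm).symm

theorem _root_.cotangent_continuousLinearMapAt (x₀ : M) {x : M}
    (hx : x ∈ (extChartAt (𝓡 n) x₀).source) (p : Euc n →L[ℝ] ℝ) :
    ((trivializationAt (Euc n →L[ℝ] ℝ) (fun x : M => TangentSpace (𝓡 n) x →L[ℝ] ℝ)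
      x₀).continuousLinearMapAt ℝ x : (TangentSpace (𝓡 n) x →L[ℝ] ℝ) → Euc n →L[ℝ] ℝ) p =
      p.comp (tanMap 𝓘(ℝ, Euc n) (𝓡 n) (extChartAt (𝓡 n) x₀).symm (extChartAt (𝓡 n) x₀ x)) := by
  have h4 : x ∈ (trivializationAt (Euc n) (TangentSpace (𝓡 n) : M → Type) x₀).baseSet := by
    simpa using hx
  rw [Bundle.Trivialization.continuousLinearMapAt_apply,
    Bundle.Trivialization.coe_linearMapAt_of_mem]
  · have h := cotangent_extChartAt_apply (mkCov x₀ 0) (mkCov x p) hx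
    exact congrArg Prod.snd h
  · rw [hom_trivializationAt_baseSet]
    exact ⟨h4, trivial⟩

theorem inCoordinates_inner (x₀ : M) {x : M} (hx : x ∈ (extChartAt (𝓡 n) x₀).source) :
    ContinuousLinearMap.inCoordinates (Euc n) (TangentSpace (𝓡 n)) (Euc n →L[ℝ] ℝ)
      (fun x : M => TangentSpace (𝓡 n) x →L[ℝ] ℝ) x₀ x x₀ x (g.inner x) =
        g.formInChart x₀ (extChartAt (𝓡 n) x₀ x) := by
  have h' : x ∈ (chartAt (Euc n) x₀).source := by simpa using hx
  have h1 := TangentBundle.symmL_trivializationAt (I := 𝓡 n) h'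
  rw [ModelWithCorners.range_eq_univ, mfderivWithin_univ] at h1
  ext v w
  rw [formInChart_apply, (extChartAt (𝓡 n) x₀).left_inv hx]
  have h2 := cotangent_continuousLinearMapAt x₀ hx (g.form x
    (tanMap 𝓘(ℝ, Euc n) (𝓡 n) (extChartAt (𝓡 n) x₀).symm (extChartAt (𝓡 n) x₀ x) v))
  have h3 := DFunLike.congr_fun h2 w
  refine Eq.trans ?_ h3
  simp only [ContinuousLinearMap.inCoordinates, h1]
  rfl

theorem formInChart_contDiffAt (x₀ : M) :
    ContDiffAt ℝ ∞ (g.formInChart x₀) (extChartAt (𝓡 n) x₀ x₀) := by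
  have h := ((contMDiffAt_hom_bundle _).1 (g.contMDiff x₀)).2
  have h3 := h.comp_of_eq (contMDiffAt_extChartAt_symm (I := 𝓡 n) (mem_extChartAt_target x₀))
    (extChartAt_to_inv x₀)
  rw [← contMDiffAt_iff_contDiffAt]
  refine h3.congr_of_eventuallyEq ?_
  filter_upwards [extChartAt_target_mem_nhds (I := 𝓡 n) x₀] with q hq
  have h5 := g.inCoordinates_inner x₀ ((extChartAt (𝓡 n) x₀).map_target hq)
  rw [(extChartAt (𝓡 n) x₀).right_inv hq] at h5
  exact h5.symm

/-- `sharp` is only a pointwise construction; smoothness comes from the coordinate formula, because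
inversion is smooth at invertible operators. -/
theorem energy_contMDiff : ContMDiff (cotangentModel n) 𝓘(ℝ, ℝ) ∞ g.energy := by
  intro α
  have hy := mem_extChartAt_target (I := cotangentModel n) α
  set y₀ := extChartAt (cotangentModel n) α α with hy₀
  have h0 : y₀.1 = extChartAt (𝓡 n) α.proj α.proj := by
    rw [hy₀, cotangent_extChartAt_apply _ _ (mem_extChartAt_source α.proj)]
  have hq : y₀.1 ∈ (extChartAt (𝓡 n) α.proj).target := by
    rw [h0]; exact mem_extChartAt_target _
  have h1 : ContDiffAt ℝ ∞
      (fun y : Phase n => y.2 ((g.formInChart α.proj y.1).inverse y.2)) y₀ := by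
    have h2 := g.formInChart_contDiffAt α.proj
    rw [← h0] at h2
    have h3 : ContDiffAt ℝ ∞ (fun y : Phase n => (g.formInChart α.proj y.1).inverse) y₀ := by
      have h4 := (g.formInChart_isInvertible α.proj hq).contDiffAt_map_inverse (n := ∞)
      exact h4.comp y₀ (h2.comp y₀ contDiffAt_fst)
    exact contDiffAt_snd.clm_apply (h3.clm_apply contDiffAt_snd)
  have h5 : ContMDiffAt (cotangentModel n) 𝓘(ℝ, ℝ) ∞
      (fun β => (fun y : Phase n => y.2 ((g.formInChart α.proj y.1).inverse y.2))
        (extChartAt (cotangentModel n) α β)) α :=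
    h1.contMDiffAt.comp α contMDiffAt_extChartAt
  refine h5.congr_of_eventuallyEq ?_
  filter_upwards [extChartAt_source_mem_nhds (I := cotangentModel n) α] with β hβ
  have := g.energy_symm α ((extChartAt (cotangentModel n) α).map_source hβ)
  rwa [(extChartAt (cotangentModel n) α).left_inv hβ] at this

/-- The energy in the chart at `α`. -/
def energyInChart (α : CotangentBundle n M) (y : Phase n) : ℝ :=
  g.energy ((extChartAt (cotangentModel n) α).symm y)

theorem energyInChart_contDiffAt (α : CotangentBundle n M) {y : Phase n}
    (hy : y ∈ (extChartAt (cotangentModel n) α).target) :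
    ContDiffAt ℝ ∞ (g.energyInChart α) y := by
  rw [← contMDiffAt_iff_contDiffAt]
  exact (g.energy_contMDiff _).comp y (contMDiffAt_extChartAt_symm hy)

theorem tanMap_energy_symm (α : CotangentBundle n M) {y : Phase n}
    (hy : y ∈ (extChartAt (cotangentModel n) α).target) :
    (tanMap (cotangentModel n) 𝓘(ℝ, ℝ) g.energy ((extChartAt (cotangentModel n) α).symm y)).comp
      (tanMap 𝓘(ℝ, Phase n) (cotangentModel n) (extChartAt (cotangentModel n) α).symm y) =
        fderiv ℝ (g.energyInChart α) y := by
  rw [← tanMap_eq_fderiv]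
  exact (tanMap_comp ((g.energy_contMDiff _).mdifferentiableAt (by simp))
    (mdifferentiableAt_extChartAt_symm hy)).symm

/-- The fibre derivative of the energy. -/
theorem fderiv_energyInChart_vertical (α : CotangentBundle n M) {y : Phase n}
    (hy : y ∈ (extChartAt (cotangentModel n) α).target) (p : Euc n →L[ℝ] ℝ) :
    fderiv ℝ (g.energyInChart α) y (0, p) = 2 * p ((g.formInChart α.proj y.1).inverse y.2) := by
  have hd := ((g.energyInChart_contDiffAt α hy).differentiableAt (by simp)).hasFDerivAt
  have hc : HasDerivAt (fun t : ℝ => ((y.1, y.2 + t • p) : Phase n)) (0, p) 0 := by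
    simpa using (hasDerivAt_const (0 : ℝ) y.1).prodMk
      (((hasDerivAt_id (0 : ℝ)).smul_const p).const_add y.2)
  have h0 : ((y.1, y.2 + (0 : ℝ) • p) : Phase n) = y := by simp
  have h1 := HasFDerivAt.comp_hasDerivAt_of_eq (0 : ℝ) hd hc h0.symm
  have hq : y.1 ∈ (extChartAt (𝓡 n) α.proj).target := by
    rw [cotangent_extChartAt_target] at hy; exact hy.1
  obtain ⟨L, hL⟩ := g.formInChart_isInvertible α.proj hq
  have hs : ∀ a b : Euc n →L[ℝ] ℝ, a (L.symm b) = b (L.symm a) := by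
    intro a b
    have := g.formInChart_symm α.proj y.1 (L.symm a) (L.symm b)
    rw [← hL] at this
    simpa using this
  -- On a line in a fibre the energy is a quadratic polynomial in `t`. The symmetry `hs` merges the
  -- two mixed terms, which is the source of the factor 2.
  have h2 : (g.energyInChart α ∘ fun t : ℝ => ((y.1, y.2 + t • p) : Phase n)) = fun t =>
      y.2 (L.symm y.2) + t * (2 * p (L.symm y.2)) + t ^ 2 * p (L.symm p) := by
    funext t
    have hyt : ((y.1, y.2 + t • p) : Phase n) ∈ (extChartAt (cotangentModel n) α).target := by
      rw [cotangent_extChartAt_target] at hy ⊢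
      exact ⟨hy.1, trivial⟩
    have := g.energy_symm α hyt
    simp only [Function.comp_apply, energyInChart]
    rw [this]
    simp only [← hL, ContinuousLinearMap.inverse_equiv]
    have := hs y.2 p
    simp [this]
    ring
  have h3 : HasDerivAt (fun t : ℝ => y.2 (L.symm y.2) + t * (2 * p (L.symm y.2)) +
      t ^ 2 * p (L.symm p)) (2 * p (L.symm y.2)) 0 := by
    have := (((hasDerivAt_id' (0 : ℝ)).mul_const (2 * p (L.symm y.2))).const_add
      (y.2 (L.symm y.2))).fun_add (((hasDerivAt_id' (0 : ℝ)).fun_pow 2).mul_const (p (L.symm p)))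
    refine this.congr_deriv ?_
    simp
  rw [h2] at h1
  rw [h1.unique h3, ← hL, ContinuousLinearMap.inverse_equiv]
  rfl

end LorentzianMetric

end Energy

/-! ### The symplectic form, and the algebra relating `X_g`, `ξ`, `θ` and `dE_g`. -/

section Symplectic

/-- The form `dq ∧ dp` on the model vector space. -/
def canonicalTwoForm (n : ℕ) : Phase n →L[ℝ] Phase n →L[ℝ] ℝ :=
  (canonicalOneForm n).flip - canonicalOneForm n

theorem canonicalTwoForm_apply {n : ℕ} (v w : Phase n) :
    canonicalTwoForm n v w = w.2 v.1 - v.2 w.1 := rfl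

theorem canonicalTwoForm_isInvertible (n : ℕ) : (canonicalTwoForm n).IsInvertible := by
  apply ContinuousLinearMap.isInvertible_of_nondegenerate
  intro v hv
  refine Prod.ext ?_ ?_
  · by_contra h
    obtain ⟨p, hp⟩ := SeparatingDual.exists_ne_zero (R := ℝ) h
    apply hp
    simpa [canonicalTwoForm_apply] using hv (0, p)
  · refine ContinuousLinearMap.ext fun w => ?_
    simpa [canonicalTwoForm_apply] using hv (w, 0)

/-- The isomorphism to the dual given by `dq ∧ dp`. -/
def symplecticEquiv (n : ℕ) : Phase n ≃L[ℝ] (Phase n →L[ℝ] ℝ) :=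
  (canonicalTwoForm_isInvertible n).choose

theorem symplecticEquiv_apply {n : ℕ} (v w : Phase n) :
    symplecticEquiv n v w = w.2 v.1 - v.2 w.1 := by
  have := (canonicalTwoForm_isInvertible n).choose_spec
  rw [← canonicalTwoForm_apply, ← this]
  rfl

variable {n : ℕ} {M : Type*} [TopologicalSpace M] [ChartedSpace (Euc n) M]
  [IsManifold (𝓡 n) ∞ M]

theorem extChartAt_self_snd (α : CotangentBundle n M) :
    (extChartAt (cotangentModel n) α α).2 = cov α := by
  rw [cotangent_extChartAt_apply _ _ (mem_extChartAt_source α.proj), tanMap_extChartAt_symm_self,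
    ContinuousLinearMap.comp_id]

theorem liouville_eq (α : CotangentBundle n M) (v : Phase n) : liouville α v = cov α v.1 := by
  have := liouville_tanMap_symm α (mem_extChartAt_target α) v
  rwa [extChartAt_to_inv, tanMap_extChartAt_symm_self, ContinuousLinearMap.id_apply,
    extChartAt_self_snd] at this

theorem euler_eq_vertical (α : CotangentBundle n M) : euler α = (0, cov α) := by
  have := euler_symm α (mem_extChartAt_target α)
  rwa [extChartAt_to_inv, tanMap_extChartAt_symm_self, ContinuousLinearMap.id_apply,
    extChartAt_self_snd] at this

namespace LorentzianMetric

variable (g : LorentzianMetric n M)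

/-- The differential of the energy. -/
def energyDeriv (α : CotangentBundle n M) : Phase n →L[ℝ] ℝ :=
  tanMap (cotangentModel n) 𝓘(ℝ, ℝ) g.energy α

/-- The cogeodesic vector field, on the model vector space. -/
def cogeodesic (α : CotangentBundle n M) : Phase n := g.cogeodesicField α

theorem isSymplecticGradient_iff (α : CotangentBundle n M) (X : Phase n) :
    g.IsSymplecticGradient α X ↔ symplecticEquiv n X = g.energyDeriv α := by
  have h : g.IsSymplecticGradient α X ↔ ∀ W : Phase n,
    -formDeriv (cotangentModel n) (liouville (n := n) (M := M)) α X W = g.energyDeriv α W := Iff.rfl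
  rw [h, ContinuousLinearMap.ext_iff]
  refine forall_congr' fun W => ?_
  rw [formDeriv_liouville, symplecticEquiv_apply, neg_sub]

/-- Nondegeneracy of the symplectic form supplies a symplectic gradient, so the `Classical.epsilon`
in `cogeodesicField` does select one. -/
theorem symplecticEquiv_cogeodesic (α : CotangentBundle n M) :
    symplecticEquiv n (g.cogeodesic α) = g.energyDeriv α := by
  rw [← isSymplecticGradient_iff]
  exact Classical.epsilon_spec (p := g.IsSymplecticGradient α)
    ⟨(symplecticEquiv n).symm (g.energyDeriv α),
      (isSymplecticGradient_iff g α _).2 ((symplecticEquiv n).apply_symm_apply _)⟩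

theorem cogeodesic_apply (α : CotangentBundle n M) (w : Phase n) :
    w.2 (g.cogeodesic α).1 - (g.cogeodesic α).2 w.1 = g.energyDeriv α w := by
  rw [← symplecticEquiv_cogeodesic, symplecticEquiv_apply]

/-- Contracting `dp ∧ dq` with the vertical vector `(0, p)` gives `p dq`; the minus sign is that of
the convention `ω = -dθ`. -/
theorem symplecticEquiv_euler (α : CotangentBundle n M) :
    symplecticEquiv n (euler α) = -liouville α := by
  refine ContinuousLinearMap.ext fun w => ?_
  rw [symplecticEquiv_apply, euler_eq_vertical]
  simp [liouville_eq]

/-- Euler's identity for a function homogeneous of degree two on the fibres. -/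
theorem energyDeriv_euler (α : CotangentBundle n M) :
    g.energyDeriv α (euler α) = 2 * g.energy α := by
  have h := g.fderiv_energyInChart_vertical α (mem_extChartAt_target α) (cov α)
  have h1 := g.energy_symm α (mem_extChartAt_target α)
  rw [← tanMap_energy_symm g α (mem_extChartAt_target α), extChartAt_to_inv,
    tanMap_extChartAt_symm_self, ContinuousLinearMap.comp_id] at h
  rw [extChartAt_to_inv, extChartAt_self_snd] at h1
  rw [extChartAt_self_snd] at h
  rw [h1, euler_eq_vertical]
  exact h

/-- The fibre derivative is twice the pairing with the vector dual to `α`, which is nonzero. That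
the direction can be vertical matters: `θ` ignores vertical vectors, so these can be used to correct
the energy component of a vector at no cost. -/
theorem exists_energyDeriv_vertical_ne_zero (α : CotangentBundle n M) (hα : cov α ≠ 0) :
    ∃ p : Euc n →L[ℝ] ℝ, g.energyDeriv α (0, p) ≠ 0 := by
  have hq : (extChartAt (cotangentModel n) α α).1 ∈ (extChartAt (𝓡 n) α.proj).target := by
    have := mem_extChartAt_target (I := cotangentModel n) α
    rw [cotangent_extChartAt_target] at this
    exact this.1
  obtain ⟨L, hL⟩ := g.formInChart_isInvertible α.proj hq
  have hne : L.symm (cov α) ≠ 0 := by simpa using hα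
  obtain ⟨p, hp⟩ := SeparatingDual.exists_ne_zero (R := ℝ) hne
  refine ⟨p, ?_⟩
  have h := g.fderiv_energyInChart_vertical α (mem_extChartAt_target α) p
  rw [← tanMap_energy_symm g α (mem_extChartAt_target α), extChartAt_to_inv,
    tanMap_extChartAt_symm_self, ContinuousLinearMap.comp_id, extChartAt_self_snd, ← hL,
    ContinuousLinearMap.inverse_equiv] at h
  have h2 : g.energyDeriv α (0, p) = 2 * p (L.symm (cov α)) := h
  rw [h2]
  exact mul_ne_zero two_ne_zero hp

theorem energyDeriv_ne_zero (α : CotangentBundle n M) (hα : cov α ≠ 0) :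
    g.energyDeriv α ≠ 0 := by
  obtain ⟨p, hp⟩ := g.exists_energyDeriv_vertical_ne_zero α hα
  intro h
  rw [h] at hp
  exact hp rfl

theorem energyDeriv_cogeodesic (α : CotangentBundle n M) :
    g.energyDeriv α (g.cogeodesic α) = 0 := by
  rw [← cogeodesic_apply, sub_self]

theorem liouville_euler (α : CotangentBundle n M) : liouville α (euler α) = 0 := by
  rw [liouville_eq, euler_eq_vertical, map_zero]

/-- Evaluate `ω(X_g, ξ)` in two ways: it is `dE_g(ξ) = 2 E_g`, and it is `θ(X_g)`. -/
theorem liouville_cogeodesic (α : CotangentBundle n M) :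
    liouville α (g.cogeodesic α) = 2 * g.energy α := by
  rw [← energyDeriv_euler, ← cogeodesic_apply, liouville_eq, euler_eq_vertical]
  simp

/-- The Euler field is vertical, whereas `X_g` is not: otherwise `dE_g` would vanish on all vertical
vectors. -/
theorem cogeodesic_euler_linearIndependent (α : CotangentBundle n M) (hα : cov α ≠ 0) :
    LinearIndependent ℝ ![g.cogeodesic α, euler α] := by
  rw [LinearIndependent.pair_iff]
  intro a b h
  obtain ⟨p, hp⟩ := g.exists_energyDeriv_vertical_ne_zero α hα
  have h1 : a • (g.cogeodesic α).1 = 0 := by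
    have := congrArg Prod.fst h
    simpa [euler_eq_vertical] using this
  have ha : a = 0 := by
    rw [smul_eq_zero] at h1
    refine h1.resolve_right fun h2 => hp ?_
    rw [← cogeodesic_apply, h2]
    simp
  subst ha
  have h2 := congrArg Prod.snd h
  simp only [zero_smul, zero_add, euler_eq_vertical, Prod.snd_zero] at h2
  exact ⟨rfl, (smul_eq_zero.1 h2).resolve_right hα⟩

/-- A vector with `θ ≠ 0` becomes tangent to the level set after subtracting a vertical one. This is
why the induced form on the leaf space has no zeros. -/
theorem exists_liouville_ne_zero (α : CotangentBundle n M) (hα : cov α ≠ 0) :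
    ∃ w : Phase n, g.energyDeriv α w = 0 ∧ liouville α w ≠ 0 := by
  obtain ⟨p, hp⟩ := g.exists_energyDeriv_vertical_ne_zero α hα
  obtain ⟨v, hv⟩ : ∃ v, cov α v ≠ 0 := by
    by_contra! h
    exact hα (ContinuousLinearMap.ext h)
  refine ⟨(v, 0) - (g.energyDeriv α (v, 0) / g.energyDeriv α (0, p)) • (0, p), ?_, ?_⟩
  · rw [map_sub, map_smul, smul_eq_mul, div_mul_cancel₀ _ hp, sub_self]
  · rw [liouville_eq]
    simpa using hv

/-- On the level set of the energy, the characteristic directions of `dθ` on `ker θ` are spanned by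
the cogeodesic and Euler vector fields. -/
theorem mem_span_of_formDeriv_eq_zero (α : CotangentBundle n M) (v : Phase n)
    (h : ∀ w : Phase n, g.energyDeriv α w = 0 → liouville α w = 0 →
      formDeriv (cotangentModel n) (liouville (n := n) (M := M)) α v w = 0) :
    ∃ a b : ℝ, v = a • g.cogeodesic α + b • euler α := by
  have h1 : (symplecticEquiv n v : Phase n →ₗ[ℝ] ℝ) ∈ Submodule.span ℝ (Set.range
      ![(g.energyDeriv α : Phase n →ₗ[ℝ] ℝ), (liouville α : Phase n →ₗ[ℝ] ℝ)]) := by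
    -- `ω(v, ·)` vanishes on the common kernel of `dE_g` and `θ`, so it is a combination of these;
    -- they equal `ω(X_g, ·)` and `-ω(ξ, ·)`.
    apply mem_span_of_iInf_ker_le_ker
    intro w hw
    rw [Submodule.mem_iInf] at hw
    have h2 := h w (hw 0) (hw 1)
    rw [formDeriv_liouville] at h2
    change symplecticEquiv n v w = 0
    rw [symplecticEquiv_apply]
    linarith
  rw [Matrix.range_cons, Matrix.range_cons, Matrix.range_empty, Set.union_empty,
    Set.singleton_union, Submodule.mem_span_pair] at h1
  obtain ⟨a, b, hab⟩ := h1
  refine ⟨a, -b, (symplecticEquiv n).injective ?_⟩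
  rw [map_add, map_smul, map_smul, symplecticEquiv_cogeodesic, symplecticEquiv_euler]
  refine ContinuousLinearMap.ext fun w => ?_
  have := DFunLike.congr_fun hab w
  simp only [LinearMap.add_apply, LinearMap.smul_apply, ContinuousLinearMap.coe_coe] at this
  rw [← this]
  simp

/-- The cogeodesic vector field in the chart at `α`. -/
def cogeodesicInChart (α : CotangentBundle n M) (y : Phase n) : Phase n :=
  (symplecticEquiv n).symm (fderiv ℝ (g.energyInChart α) y)

theorem cogeodesicInChart_contDiffAt (α : CotangentBundle n M) {y : Phase n}
    (hy : y ∈ (extChartAt (cotangentModel n) α).target) :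
    ContDiffAt ℝ ∞ (g.cogeodesicInChart α) y :=
  (symplecticEquiv n).symm.contDiff.contDiffAt.comp y
    ((g.energyInChart_contDiffAt α hy).fderiv_right (by simp))

/-- Canonical charts preserve the symplectic form, hence carry symplectic gradients to symplectic
gradients. Integral curves of `X_g` can therefore be found in coordinates. -/
theorem tanMap_cogeodesicInChart (α : CotangentBundle n M) {y : Phase n}
    (hy : y ∈ (extChartAt (cotangentModel n) α).target) :
    tanMap 𝓘(ℝ, Phase n) (cotangentModel n) (extChartAt (cotangentModel n) α).symm y
      (g.cogeodesicInChart α y) = g.cogeodesic ((extChartAt (cotangentModel n) α).symm y) := by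
  apply (symplecticEquiv n).injective
  rw [symplecticEquiv_cogeodesic]
  refine ContinuousLinearMap.ext fun w => ?_
  have h1 := formDeriv_liouville_tanMap_symm α hy (g.cogeodesicInChart α y)
    (tanMap (cotangentModel n) 𝓘(ℝ, Phase n) (extChartAt (cotangentModel n) α)
      ((extChartAt (cotangentModel n) α).symm y) w)
  have h2 := DFunLike.congr_fun (g.tanMap_energy_symm α hy)
    (tanMap (cotangentModel n) 𝓘(ℝ, Phase n) (extChartAt (cotangentModel n) α)
      ((extChartAt (cotangentModel n) α).symm y) w)
  rw [ContinuousLinearMap.comp_apply] at h2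
  rw [tanMap_symm_tanMap_extChartAt hy] at h1 h2
  have h3 := (symplecticEquiv n).apply_symm_apply (fderiv ℝ (g.energyInChart α) y)
  rw [energyDeriv, h2, ← h3, symplecticEquiv_apply, symplecticEquiv_apply]
  rw [formDeriv_liouville] at h1
  change _ = _ - (g.cogeodesicInChart α y).2 _
  rw [← neg_sub, h1, neg_sub]
  rfl

end LorentzianMetric

end Symplectic

/-! ### Calculus on level sets, integral curves, sections, and transport along characteristics. -/

section Calculus

variable {P : Type*} [NormedAddCommGroup P] [NormedSpace ℝ P]
  {Q : Type*} [NormedAddCommGroup Q] [NormedSpace ℝ Q]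

/-- A map which vanishes on a regular level set has vanishing derivative along it. -/
theorem HasStrictFDerivAt.apply_eq_zero_of_eqOn_levelSet [CompleteSpace P] {E : P → ℝ}
    {E' : P →L[ℝ] ℝ} {φ : P → Q} {φ' : P →L[ℝ] Q} {y : P} (hE : HasStrictFDerivAt E E' y)
    (hE' : E' ≠ 0) (hφ : HasStrictFDerivAt φ φ' y) (h : ∀ᶠ z in 𝓝 y, E z = E y → φ z = φ y)
    {w : P} (hw : E' w = 0) : φ' w = 0 := by
  by_contra hne
  obtain ⟨ℓ, hℓ⟩ := SeparatingDual.exists_ne_zero (R := ℝ) hne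
  -- `ℓ ∘ φ` is constant on the level set, so `y` is a constrained extremum. The multiplier rule
  -- gives `Λ ∘ E' + c (ℓ ∘ φ') = 0` with `(Λ, c) ≠ 0`; evaluation at `w` forces `c = 0`, and then
  -- `E' ≠ 0` forces `Λ = 0`.
  have h1 : IsLocalExtrOn (fun z => ℓ (φ z)) {z | E z = E y} y := by
    left
    rw [IsMinFilter, eventually_nhdsWithin_iff]
    filter_upwards [h] with z hz hz'
    rw [hz hz']
  obtain ⟨Λ, c, hne', hΛ⟩ := h1.exists_linear_map_of_hasStrictFDerivAt hE
    (ℓ.hasStrictFDerivAt.comp y hφ)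
  have hΛ1 : ∀ r : ℝ, Λ r = r * Λ 1 := fun r => by
    rw [← smul_eq_mul, ← map_smul, smul_eq_mul, mul_one]
  have h2 := hΛ w
  simp only [hw, map_zero, zero_add, ContinuousLinearMap.comp_apply, smul_eq_mul] at h2
  have hc : c = 0 := (mul_eq_zero.1 h2).resolve_right hℓ
  obtain ⟨v, hv⟩ : ∃ v, E' v ≠ 0 := by
    by_contra! h; exact hE' (ContinuousLinearMap.ext h)
  have h3 := hΛ v
  rw [hc, zero_smul, add_zero, hΛ1] at h3
  have h4 : Λ 1 = 0 := (mul_eq_zero.1 h3).resolve_left hv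
  refine hne' (Prod.ext (LinearMap.ext fun r => ?_) hc)
  rw [hΛ1, h4, mul_zero]
  rfl

/-- A curve in a vector space whose velocity is everywhere proportional to its position moves
on a ray. -/
theorem eventually_exists_smul_eq_of_hasDerivAt_smul {m : ℝ → Q} {t₀ : ℝ} (h0 : m t₀ ≠ 0)
    (h : ∀ᶠ t in 𝓝 t₀, ∃ b : ℝ, HasDerivAt m (b • m t) t) :
    ∀ᶠ t in 𝓝 t₀, ∃ c : ℝ, c ≠ 0 ∧ m t = c • m t₀ := by
  obtain ⟨ℓ, hℓ⟩ := SeparatingDual.exists_ne_zero (R := ℝ) h0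
  have hc : ContinuousAt m t₀ := by
    obtain ⟨b, hb⟩ := h.self_of_nhds
    exact hb.continuousAt
  have h1 : ∀ᶠ t in 𝓝 t₀, ℓ (m t) ≠ 0 :=
    (ℓ.continuous.continuousAt.comp hc).eventually_ne hℓ
  obtain ⟨ε, hε, hball⟩ := Metric.eventually_nhds_iff_ball.1 (h.and h1)
  -- Both `m` and `ℓ ∘ m` grow at the same logarithmic rate `b`, so their quotient is stationary.
  have h2 : ∀ t ∈ Metric.ball t₀ ε, HasDerivAt (fun t => (ℓ (m t))⁻¹ • m t) 0 t := by
    intro t ht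
    obtain ⟨⟨b, hb⟩, hne⟩ := hball t ht
    have h3 : HasDerivAt (fun t => ℓ (m t)) (ℓ (b • m t)) t := ℓ.hasFDerivAt.comp_hasDerivAt t hb
    refine ((h3.fun_inv hne).fun_smul hb).congr_deriv ?_
    rw [map_smul, smul_smul, ← add_smul, smul_eq_mul]
    convert zero_smul ℝ (m t)
    field_simp
    ring
  filter_upwards [Metric.ball_mem_nhds t₀ hε] with t ht
  have h4 : (ℓ (m t))⁻¹ • m t = (ℓ (m t₀))⁻¹ • m t₀ := by
    refine (convex_ball t₀ ε).is_const_of_fderivWithin_eq_zero (𝕜 := ℝ)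
      (f := fun t => (ℓ (m t))⁻¹ • m t)
      (fun s hs => (h2 s hs).differentiableAt.differentiableWithinAt) (fun s hs => ?_) ht
      (Metric.mem_ball_self hε)
    rw [fderivWithin_of_isOpen Metric.isOpen_ball hs, (h2 s hs).hasFDerivAt.fderiv]
    simp
  have hne := (hball t ht).2
  refine ⟨ℓ (m t) * (ℓ (m t₀))⁻¹, mul_ne_zero hne (inv_ne_zero hℓ), ?_⟩
  rw [mul_smul, ← h4, smul_smul, mul_inv_cancel₀ hne, one_smul]

/-- Integral curves of a smooth vector field exist locally and are smooth. -/
theorem exists_contDiffOn_integralCurve [CompleteSpace P] {X : P → P} {O : Set P} (hO : IsOpen O)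
    (hX : ∀ y ∈ O, ContDiffAt ℝ ∞ X y) {y₀ : P} (hy₀ : y₀ ∈ O) :
    ∃ c : ℝ → P, c 0 = y₀ ∧ ∃ ε > 0, ContDiffOn ℝ ∞ c (Metric.ball 0 ε) ∧
      ∀ t ∈ Metric.ball (0 : ℝ) ε, c t ∈ O ∧ HasDerivAt c (X (c t)) t := by
  obtain ⟨c, hc0, ε, hε, hc⟩ :=
    ContDiffAt.exists_forall_mem_closedBall_exists_eq_forall_mem_Ioo_hasDerivAt₀
    ((hX y₀ hy₀).of_le (by exact_mod_cast le_top : (1 : WithTop ℕ∞) ≤ ∞)) 0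
  have hcont : ContinuousAt c 0 := (hc 0 (by simp [hε])).continuousAt
  have hcO : ∀ᶠ t in 𝓝 (0 : ℝ), c t ∈ O := hcont.eventually (hO.mem_nhds (by rwa [hc0]))
  have hI : ∀ᶠ t in 𝓝 (0 : ℝ), t ∈ Set.Ioo (0 - ε) (0 + ε) := Ioo_mem_nhds (by simpa) (by simpa)
  obtain ⟨δ, hδ, hball⟩ := Metric.eventually_nhds_iff_ball.1 (hcO.and hI)
  have hder : ∀ t ∈ Metric.ball (0 : ℝ) δ, HasDerivAt c (X (c t)) t :=
    fun t ht => hc t (hball t ht).2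
  refine ⟨c, hc0, δ, hδ, ?_, fun t ht => ⟨(hball t ht).1, hder t ht⟩⟩
  rw [contDiffOn_infty]
  intro k
  -- Bootstrapping: if `c` is `Cᵏ`, so is its derivative `X ∘ c`, and `c` is `Cᵏ⁺¹`.
  induction k with
  | zero =>
    rw [Nat.cast_zero, contDiffOn_zero]
    exact fun t ht => (hder t ht).continuousAt.continuousWithinAt
  | succ k ih =>
    rw [Nat.cast_succ, contDiffOn_succ_iff_deriv_of_isOpen Metric.isOpen_ball]
    refine ⟨fun t ht => (hder t ht).differentiableAt.differentiableWithinAt, by simp, ?_⟩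
    have h1 : ContDiffOn ℝ k (fun t => X (c t)) (Metric.ball 0 δ) := fun t ht =>
      ((hX _ (hball t ht).1).of_le (by exact_mod_cast le_top)).comp_contDiffWithinAt t (ih t ht)
    exact h1.congr fun t ht => (hder t ht).deriv

/-- A smooth submersion between finite dimensional spaces has smooth local sections. -/
theorem exists_contDiffOn_section [FiniteDimensional ℝ P] [FiniteDimensional ℝ Q] {h : P → Q}
    {O : Set P} (hO : IsOpen O) (hh : ∀ y ∈ O, ContDiffAt ℝ ∞ h y) {y₀ : P} (hy₀ : y₀ ∈ O)
    (hs : Function.Surjective (fderiv ℝ h y₀)) :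
    ∃ (s : Q → P) (W : Set Q), IsOpen W ∧ h y₀ ∈ W ∧ s (h y₀) = y₀ ∧
      ∀ r ∈ W, ContDiffAt ℝ ∞ s r ∧ s r ∈ O ∧ h (s r) = r := by
  obtain ⟨R₀, hR₀⟩ := (fderiv ℝ h y₀ : P →ₗ[ℝ] Q).exists_rightInverse_of_surjective
    (LinearMap.range_eq_top.2 hs)
  have : CompleteSpace Q := FiniteDimensional.complete ℝ Q
  set R : Q →L[ℝ] P := LinearMap.toContinuousLinearMap R₀ with hR
  have hR1 : (fderiv ℝ h y₀).comp R = ContinuousLinearMap.id ℝ Q := by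
    ext q
    exact LinearMap.congr_fun hR₀ q
  -- On the affine slice through `y₀` in the direction of a right inverse of `dh`, the map `h` has
  -- derivative the identity, and the inverse function theorem applies.
  set a : Q → P := fun z => y₀ + R z with ha
  have has : ContDiff ℝ ∞ a := contDiff_const.add R.contDiff
  have ha0 : a 0 = y₀ := by simp [ha]
  have had : ∀ z, HasFDerivAt a R z := fun z => R.hasFDerivAt.const_add y₀
  set k : Q → Q := fun z => h (a z) with hk
  set O' : Set Q := a ⁻¹' O with hO'
  have hO'o : IsOpen O' := hO.preimage has.continuous
  have h0 : (0 : Q) ∈ O' := by simpa [hO', ha0] using hy₀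
  have hks : ∀ z ∈ O', ContDiffAt ℝ ∞ k z := fun z hz => (hh _ hz).comp z has.contDiffAt
  have hk0 : HasFDerivAt k ((ContinuousLinearEquiv.refl ℝ Q : Q ≃L[ℝ] Q) : Q →L[ℝ] Q) 0 := by
    have h1 : HasFDerivAt h (fderiv ℝ h y₀) (a 0) := by
      rw [ha0]; exact ((hh y₀ hy₀).differentiableAt (by simp)).hasFDerivAt
    have h2 := h1.comp (0 : Q) (had 0)
    rw [hR1] at h2
    exact h2
  set e := (hks 0 h0).toOpenPartialHomeomorph k hk0 (by simp) with he
  have he0 : (0 : Q) ∈ e.source := (hks 0 h0).mem_toOpenPartialHomeomorph_source hk0 (by simp)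
  have hek : ∀ z, e z = k z := fun z => rfl
  -- The inverse has to be smooth on a whole neighbourhood, not only at `h y₀`; hence the
  -- restriction to points where the derivative of `k` stays invertible.
  have hinv : ∀ᶠ z in 𝓝 (0 : Q), (fderiv ℝ k z).IsInvertible := by
    have hc : ContinuousAt (fderiv ℝ k) 0 :=
      ((hks 0 h0).fderiv_right (m := 0) (by simp)).continuousAt
    have h1 := hc.eventually (p := fun A : Q →L[ℝ] Q => A.IsInvertible)
      (by
        rw [hk0.fderiv]
        exact ContinuousLinearEquiv.nhds (ContinuousLinearEquiv.refl ℝ Q))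
    exact h1
  obtain ⟨V, hV, hVo, hV0⟩ := eventually_nhds_iff.1 hinv
  have hk00 : k 0 = h y₀ := by simp only [hk, ha0]
  refine ⟨fun r => a (e.symm r), e.target ∩ e.symm ⁻¹' (O' ∩ V),
    e.isOpen_inter_preimage_symm (hO'o.inter hVo), ?_, ?_, ?_⟩
  · have h1 : e.symm (h y₀) = 0 := by rw [← hk00, ← hek]; exact e.left_inv he0
    refine ⟨?_, ?_⟩
    · rw [← hk00, ← hek]; exact e.map_source he0
    · change e.symm (h y₀) ∈ O' ∩ V
      rw [h1]; exact ⟨h0, hV0⟩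
  · have h1 : e.symm (h y₀) = 0 := by rw [← hk00, ← hek]; exact e.left_inv he0
    simp only [h1, ha0]
  · rintro r ⟨hr1, hr2⟩
    refine ⟨has.contDiffAt.comp r ?_, hr2.1, ?_⟩
    · obtain ⟨L, hL⟩ := hV _ hr2.2
      refine e.contDiffAt_symm (f₀' := L) hr1 ?_ (hks _ hr2.1)
      rw [hL]
      exact ((hks _ hr2.1).differentiableAt (by simp)).hasFDerivAt
    · exact e.right_inv hr1

/-- Parallel transport of the kernel of a 1-form along its characteristics: let `θ` be a 1-form
vanishing on the fibres of a submersion `h` over `{0} × Q`. Along a curve in such a fibre whose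
velocity satisfies `dθ(y', ·) = b θ`, the hyperplane field on `Q` induced by `θ` is constant. -/
theorem eventually_kernel_iff_of_characteristic [FiniteDimensional ℝ P] [FiniteDimensional ℝ Q]
    {h : P → ℝ × Q} {θ : P → P →L[ℝ] ℝ} {y : ℝ → P} {t₀ : ℝ}
    (hh : ContDiffAt ℝ 2 h (y t₀)) (hθ : ContDiffAt ℝ 1 θ (y t₀))
    (hs : Function.Surjective (fderiv ℝ h (y t₀)))
    (hker : ∀ᶠ z in 𝓝 (y t₀), (h z).1 = 0 → ∀ v, fderiv ℝ h z v = 0 → θ z v = 0)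
    (hne : ∃ w, (fderiv ℝ h (y t₀) w).1 = 0 ∧ θ (y t₀) w ≠ 0)
    (hcurve : ∀ᶠ t in 𝓝 t₀, (h (y t)).1 = 0 ∧ ∃ y', HasDerivAt y y' t ∧
      fderiv ℝ h (y t) y' = 0 ∧ ∃ b : ℝ, ∀ w, (fderiv ℝ h (y t) w).1 = 0 →
        fderiv ℝ θ (y t) y' w - fderiv ℝ θ (y t) w y' = b * θ (y t) w) :
    ∀ᶠ t in 𝓝 t₀, ∀ v₀ v u,
      fderiv ℝ h (y t₀) v₀ = (0, u) → fderiv ℝ h (y t) v = (0, u) →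
        (θ (y t) v = 0 ↔ θ (y t₀) v₀ = 0) := by
  have : CompleteSpace P := FiniteDimensional.complete ℝ P
  have : CompleteSpace Q := FiniteDimensional.complete ℝ Q
  obtain ⟨R₀, hR₀⟩ := (fderiv ℝ h (y t₀) : P →ₗ[ℝ] ℝ × Q).exists_rightInverse_of_surjective
    (LinearMap.range_eq_top.2 hs)
  set R : ℝ × Q →L[ℝ] P := LinearMap.toContinuousLinearMap R₀ with hR
  have hR1 : (fderiv ℝ h (y t₀)).comp R = ContinuousLinearMap.id ℝ (ℝ × Q) :=
    ContinuousLinearMap.ext fun q => LinearMap.congr_fun hR₀ q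
  set A : P → (ℝ × Q) →L[ℝ] (ℝ × Q) := fun z => (fderiv ℝ h z).comp R with hA
  have hAid : ∀ᶠ z in 𝓝 (y t₀), (A z).IsInvertible := by
    have hc : ContinuousAt A (y t₀) :=
      ((hh.fderiv_right (m := 1) (by norm_num)).continuousAt).clm_comp continuousAt_const
    refine hc.eventually (p := fun A : (ℝ × Q) →L[ℝ] (ℝ × Q) => A.IsInvertible) ?_
    rw [hA]
    simp only [hR1]
    exact ContinuousLinearEquiv.nhds (ContinuousLinearEquiv.refl ℝ (ℝ × Q))
  -- A right inverse of `dh` that varies differentiably with the point. Wherever `θ` vanishes on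
  -- `ker dh`, it gives `θ = λ ∘ dh` with `λ = θ ∘ S`.
  set S : P → (ℝ × Q) →L[ℝ] P := fun z => R.comp (A z).inverse with hS
  set lam : P → (ℝ × Q) →L[ℝ] ℝ := fun z => (θ z).comp (S z) with hlam
  have hgood : ∀ᶠ z in 𝓝 (y t₀), ContDiffAt ℝ 2 h z ∧ ContDiffAt ℝ 1 θ z ∧
      (A z).IsInvertible ∧ ((h z).1 = 0 → ∀ v, fderiv ℝ h z v = 0 → θ z v = 0) :=
    (hh.eventually (by simp)).and ((hθ.eventually (by simp)).and (hAid.and hker))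
  have hSr : ∀ z, (A z).IsInvertible → ∀ q, fderiv ℝ h z (S z q) = q := by
    rintro z ⟨L, hL⟩ q
    have h1 : fderiv ℝ h z (S z q) = A z ((A z).inverse q) := rfl
    rw [h1, ← hL, ContinuousLinearMap.inverse_equiv]
    simp
  have hfact : ∀ z, (A z).IsInvertible → (∀ v, fderiv ℝ h z v = 0 → θ z v = 0) →
      θ z = (lam z).comp (fderiv ℝ h z) := by
    intro z hz hz2
    refine ContinuousLinearMap.ext fun v => ?_
    have h1 := hz2 (v - S z (fderiv ℝ h z v)) (by rw [map_sub, hSr z hz, sub_self])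
    rw [map_sub, sub_eq_zero] at h1
    exact h1
  have hyc : ContinuousAt y t₀ := by
    obtain ⟨-, y', h1, -⟩ := hcurve.self_of_nhds
    exact h1.continuousAt
  -- The covector on `Q` induced by `θ` at `y t`. It will satisfy `m' = b m`, so its kernel does not
  -- move.
  set m : ℝ → Q →L[ℝ] ℝ := fun t => (lam (y t)).comp (ContinuousLinearMap.inr ℝ ℝ Q) with hm
  have hderiv : ∀ᶠ t in 𝓝 t₀, ∃ b : ℝ, HasDerivAt m (b • m t) t := by
    filter_upwards [hcurve, hyc.eventually hgood.eventually_nhds] with t ht hz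
    obtain ⟨hE, y', hy', hhy', b, hb⟩ := ht
    obtain ⟨hz1, hz2, hz3, hz4⟩ := hz.self_of_nhds
    have hAd : ContDiffAt ℝ 1 A (y t) :=
      (hz1.fderiv_right (m := 1) (by norm_num)).clm_comp contDiffAt_const
    have hSd : ContDiffAt ℝ 1 S (y t) :=
      contDiffAt_const.clm_comp ((hz3.contDiffAt_map_inverse).comp _ hAd)
    have hld : ContDiffAt ℝ 1 lam (y t) := hz2.clm_comp hSd
    have hld' := (hld.differentiableAt one_ne_zero).hasFDerivAt
    refine ⟨b, ?_⟩
    have h1 := hld'.comp_hasDerivAt t hy'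
    have h2 : HasDerivAt m ((fderiv ℝ lam (y t) y').comp (ContinuousLinearMap.inr ℝ ℝ Q)) t := by
      have := h1.clm_comp (hasDerivAt_const t (ContinuousLinearMap.inr ℝ ℝ Q))
      simpa using this
    refine h2.congr_deriv ?_
    refine ContinuousLinearMap.ext fun u => ?_
    have hwu := hSr _ hz3 (0, u)
    set w := S (y t) (0, u) with hw
    -- the form `θ - λ ∘ dh` vanishes on the level set
    have hfd : ContDiffAt ℝ 1 (fderiv ℝ h) (y t) := hz1.fderiv_right (by norm_num)
    have hω := (hz2.sub (hld.clm_comp hfd)).hasStrictFDerivAt one_ne_zero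
    have hcE : HasStrictFDerivAt (fun z => (h z).1)
        ((ContinuousLinearMap.fst ℝ ℝ Q).comp (fderiv ℝ h (y t))) (y t) :=
      (ContinuousLinearMap.fst ℝ ℝ Q).hasStrictFDerivAt.comp _
        (hz1.hasStrictFDerivAt two_ne_zero)
    have hcE0 : (ContinuousLinearMap.fst ℝ ℝ Q).comp (fderiv ℝ h (y t)) ≠ 0 := by
      intro h0
      have h3 := DFunLike.congr_fun h0 (S (y t) (1, 0))
      rw [ContinuousLinearMap.comp_apply, hSr _ hz3] at h3
      simp at h3
    have hvan : ∀ v, (fderiv ℝ h (y t) v).1 = 0 →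
        fderiv ℝ (θ - fun z => (lam z).comp (fderiv ℝ h z)) (y t) v = 0 := by
      intro v hv
      refine hcE.apply_eq_zero_of_eqOn_levelSet hcE0 hω ?_ hv
      filter_upwards [hz] with z hz' hzE
      have e1 := hfact z hz'.2.2.1 (hz'.2.2.2 (by rw [hzE, hE]))
      have e2 := hfact (y t) hz3 (hz4 hE)
      rw [← e1, ← e2, sub_self, sub_self]
    have hform : ∀ v v', fderiv ℝ (θ - fun z => (lam z).comp (fderiv ℝ h z)) (y t) v v' =
        fderiv ℝ θ (y t) v v' - (fderiv ℝ lam (y t) v (fderiv ℝ h (y t) v') +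
          lam (y t) (fderiv ℝ (fderiv ℝ h) (y t) v v')) := by
      intro v v'
      have h3 := (hz2.differentiableAt one_ne_zero).hasFDerivAt.sub
        (hld'.clm_comp (hfd.differentiableAt one_ne_zero).hasFDerivAt)
      have h4 := h3.fderiv
      rw [h4]
      simp only [sub_apply, add_apply, ContinuousLinearMap.comp_apply,
        ContinuousLinearMap.compL_apply, ContinuousLinearMap.flip_apply]
      ring
    -- Differentiate `θ = λ ∘ dh` along `y'` and along `w`, both tangent to the level set, and
    -- subtract. The second derivatives of `h` cancel by symmetry and `dh y' = 0` removes a further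
    -- term, leaving `(Dλ y')(0, u) = dθ(y', w) = b θ(w)`.
    have e1 := hform y' w
    rw [hvan y' (by rw [hhy']; rfl)] at e1
    have e2 := hform w y'
    rw [hvan w (by rw [hwu])] at e2
    have e3 := hb w (by rw [hwu])
    have e4 := (hz1.isSymmSndFDerivAt (by simp)).eq y' w
    rw [hhy', map_zero] at e2
    rw [hwu] at e1
    change (0 : ℝ) = _ at e1 e2
    have e5 : θ (y t) w = m t u := rfl
    change fderiv ℝ lam (y t) y' (0, u) = b * m t u
    rw [← e5, ← e3]
    rw [e4] at e1
    linarith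
  have hm0 : m t₀ ≠ 0 := by
    obtain ⟨w, hw1, hw2⟩ := hne
    obtain ⟨-, -, h3, h4⟩ := hgood.self_of_nhds
    have h5 := DFunLike.congr_fun (hfact _ h3 (h4 hcurve.self_of_nhds.1)) w
    intro h0
    apply hw2
    rw [h5]
    have h6 : fderiv ℝ h (y t₀) w = (0, (fderiv ℝ h (y t₀) w).2) := Prod.ext hw1 rfl
    rw [ContinuousLinearMap.comp_apply, h6]
    exact DFunLike.congr_fun h0 _
  have hprop := eventually_exists_smul_eq_of_hasDerivAt_smul hm0 hderiv
  filter_upwards [hprop, hcurve, hyc.eventually hgood] with t ht ht2 ht3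
  intro v₀ v u hv₀ hv
  obtain ⟨-, -, h3, h4⟩ := hgood.self_of_nhds
  have e0 := DFunLike.congr_fun (hfact _ h3 (h4 hcurve.self_of_nhds.1)) v₀
  have e1 := DFunLike.congr_fun (hfact _ ht3.2.2.1 (ht3.2.2.2 ht2.1)) v
  rw [ContinuousLinearMap.comp_apply, hv₀] at e0
  rw [ContinuousLinearMap.comp_apply, hv] at e1
  obtain ⟨c, hc, hmc⟩ := ht
  have e2 : θ (y t) v = c * θ (y t₀) v₀ := by
    rw [e0, e1]
    exact DFunLike.congr_fun hmc u
  rw [e2, mul_eq_zero, or_iff_right hc]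

end Calculus

/-! ### A dimension count for kernels. -/

section LinearAlgebra

/-- Two independent vectors in the kernel of a surjection with two-dimensional kernel span it. -/
theorem exists_eq_add_smul_of_surjective {P Q : Type*} [AddCommGroup P] [Module ℝ P]
    [FiniteDimensional ℝ P] [AddCommGroup Q] [Module ℝ Q] [FiniteDimensional ℝ Q]
    (T : P →ₗ[ℝ] Q) (hT : Function.Surjective T)
    (hdim : Module.finrank ℝ P = Module.finrank ℝ Q + 2) {x z : P}
    (hxz : LinearIndependent ℝ ![x, z]) (hx : T x = 0) (hz : T z = 0) {v : P} (hv : T v = 0) :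
    ∃ a b : ℝ, v = a • x + b • z := by
  have h1 := T.finrank_range_add_finrank_ker
  rw [LinearMap.range_eq_top.2 hT, finrank_top, hdim] at h1
  have h2 : Submodule.span ℝ (Set.range ![x, z]) ≤ LinearMap.ker T := by
    rw [Submodule.span_le]
    rintro _ ⟨i, rfl⟩
    fin_cases i
    · exact hx
    · exact hz
  have h3 := finrank_span_eq_card hxz
  rw [Fintype.card_fin] at h3
  have h4 := Submodule.eq_of_le_of_finrank_eq h2 (by rw [h3]; omega)
  have h5 : v ∈ Submodule.span ℝ (Set.range ![x, z]) := by rw [h4]; exact hv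
  rw [Matrix.range_cons, Matrix.range_cons, Matrix.range_empty, Set.union_empty,
    Set.singleton_union, Submodule.mem_span_pair] at h5
  obtain ⟨a, b, hab⟩ := h5
  exact ⟨a, b, hab.symm⟩

end LinearAlgebra

/-! ### The future null cone and curves in its leaves. -/

section NullCone

variable {n : ℕ} {M : Type*} [TopologicalSpace M] [ChartedSpace (Euc n) M]
  [IsManifold (𝓡 n) ∞ M]

theorem finrank_phase : Module.finrank ℝ (Phase n) = 2 * n := by
  rw [Module.finrank_prod, finrank_continuousDual, finrank_euclideanSpace, Fintype.card_fin]
  ring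

variable {g : LorentzianMetric n M} (τ : TimeOrientation g)

/-- The pairing of a covector with the time orientation. -/
def TimeOrientation.pairing (α : CotangentBundle n M) : ℝ := α.snd (τ.field α.proj)

theorem TimeOrientation.pairing_mkCov (x : M) (p : Euc n →L[ℝ] ℝ) :
    τ.pairing (mkCov x p) = p (τ.field x : Euc n) := rfl

theorem TimeOrientation.continuous_pairing : Continuous τ.pairing := by
  have h1 : Continuous fun α : CotangentBundle n M =>
      (⟨α.proj, α.snd⟩ : TotalSpace (Euc n →L[ℝ] ℝ) fun x : M => TangentSpace (𝓡 n) x →L[ℝ] ℝ) :=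
    continuous_id
  have h2 : Continuous fun α : CotangentBundle n M =>
      (⟨α.proj, τ.field α.proj⟩ : TotalSpace (Euc n) (TangentSpace (𝓡 n) : M → Type)) :=
    τ.continuous.comp (FiberBundle.continuous_proj _ _)
  have h3 : Continuous fun α : CotangentBundle n M =>
      (⟨α.proj, α.snd (τ.field α.proj)⟩ : TotalSpace ℝ (Bundle.Trivial M ℝ)) := by
    rw [continuous_iff_continuousAt] at h1 h2 ⊢
    exact fun α => ContinuousAt.clm_bundle_apply (F₁ := Euc n) (F₂ := ℝ) (h1 α) (h2 α)
  have h4 : Continuous fun p : TotalSpace ℝ (Bundle.Trivial M ℝ) => p.2 :=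
    continuous_snd.comp (Bundle.Trivial.homeomorphProd M ℝ).continuous
  exact h4.comp h3

/-- Since `g(♯α, τ) = α(τ)`, being future pointing is the sign condition `α(τ) < 0`, which also
excludes `α = 0`. The condition is open, so the cone is open in the zero level of the energy. -/
theorem mem_dualNullCone_iff (α : CotangentBundle n M) :
    α ∈ dualNullCone g τ ↔ g.energy α = 0 ∧ τ.pairing α < 0 := by
  constructor
  · rintro ⟨h1, -, v, ⟨-, h2⟩, h3⟩
    refine ⟨h1, ?_⟩
    rw [TimeOrientation.pairing, h3]
    exact h2
  · rintro ⟨h1, h2⟩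
    refine ⟨h1, ?_, g.sharp α.proj α.snd, ⟨h1.le, ?_⟩, (g.inner_sharp _ _).symm⟩
    · intro h0
      rw [TimeOrientation.pairing, h0] at h2
      exact lt_irrefl _ h2
    · rw [g.inner_sharp]
      exact h2

theorem cov_ne_zero_of_mem {α : CotangentBundle n M} (hα : α ∈ dualNullCone g τ) : cov α ≠ 0 :=
  hα.2.1

theorem energy_eq_zero_of_mem {α : CotangentBundle n M} (hα : α ∈ dualNullCone g τ) :
    g.energy α = 0 :=
  hα.1

theorem eventually_mem_dualNullCone {α : CotangentBundle n M} (hα : α ∈ dualNullCone g τ) :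
    ∀ᶠ β in 𝓝 α, g.energy β = 0 → β ∈ dualNullCone g τ := by
  have h := τ.continuous_pairing.continuousAt.eventually
    (isOpen_Iio.mem_nhds ((mem_dualNullCone_iff τ α).1 hα).2)
  filter_upwards [h] with β hβ hβ2
  exact (mem_dualNullCone_iff τ β).2 ⟨hβ2, hβ⟩

variable (g) in
/-- The distribution spanned by the cogeodesic and the Euler vector field. -/
def nullDist (α : CotangentBundle n M) : Submodule ℝ (Phase n) :=
  Submodule.span ℝ {g.cogeodesic α, euler α}

theorem joinedByTangentCurve_iff (α β : dualNullCone g τ) :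
    JoinedByTangentCurve g τ α β ↔ ∃ c : ℝ → CotangentBundle n M,
      ContMDiff 𝓘(ℝ, ℝ) (cotangentModel n) ∞ c ∧ c 0 = α ∧ c 1 = β ∧ ∀ t : ℝ,
        c t ∈ dualNullCone g τ ∧ tanMap 𝓘(ℝ, ℝ) (cotangentModel n) c t 1 ∈ nullDist g (c t) :=
  Iff.rfl

/-- A smooth curve, defined near `[-ε, ε]`, in the null cone and tangent to the distribution. -/
structure IsLeafCurve (γ : ℝ → CotangentBundle n M) (ε : ℝ) : Prop where
  pos : 0 < ε
  contMDiffAt : ∀ t ∈ Metric.ball (0 : ℝ) ε, ContMDiffAt 𝓘(ℝ, ℝ) (cotangentModel n) ∞ γ t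
  mem : ∀ t ∈ Metric.ball (0 : ℝ) ε, γ t ∈ dualNullCone g τ
  tangent : ∀ t ∈ Metric.ball (0 : ℝ) ε,
    tanMap 𝓘(ℝ, ℝ) (cotangentModel n) γ t 1 ∈ nullDist g (γ t)

variable {τ}

theorem IsLeafCurve.toLeaf_eq {γ : ℝ → CotangentBundle n M} {ε : ℝ} (h : IsLeafCurve τ γ ε)
    {t : ℝ} (ht : t ∈ Metric.ball (0 : ℝ) ε) :
    toLeaf g τ ⟨γ t, h.mem t ht⟩ = toLeaf g τ ⟨γ 0, h.mem 0 (Metric.mem_ball_self h.pos)⟩ := by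
  symm
  apply Quotient.sound
  apply Relation.EqvGen.rel
  rw [joinedByTangentCurve_iff]
  -- Leaf equivalence asks for a curve on all of `ℝ`, running from time `0` to time `1`. This
  -- reparametrization goes from `0` to `t` and never leaves `[-|t|, |t|]`, where `γ` is controlled.
  set σ : ℝ → ℝ := fun r => t * Real.sin (Real.pi / 2 * r) with hσ
  have hσs : ContDiff ℝ ∞ σ := contDiff_const.mul (Real.contDiff_sin.comp
    (contDiff_const.mul contDiff_id))
  have hσb : ∀ r, σ r ∈ Metric.ball (0 : ℝ) ε := by
    intro r
    rw [Metric.mem_ball, dist_zero_right, Real.norm_eq_abs] at ht ⊢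
    rw [hσ, abs_mul]
    exact lt_of_le_of_lt (mul_le_of_le_one_right (abs_nonneg t) (Real.abs_sin_le_one _)) ht
  refine ⟨fun r => γ (σ r), fun r => (h.contMDiffAt _ (hσb r)).comp r hσs.contMDiff.contMDiffAt,
    by simp [hσ], by simp [hσ], fun r => ⟨h.mem _ (hσb r), ?_⟩⟩
  have hd : DifferentiableAt ℝ σ r := hσs.contDiffAt.differentiableAt (by simp)
  rw [tanMap_comp ((h.contMDiffAt _ (hσb r)).mdifferentiableAt (by simp)) hd.mdifferentiableAt,
    tanMap_eq_fderiv, ContinuousLinearMap.comp_apply]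
  have h1 : fderiv ℝ σ r 1 = (fderiv ℝ σ r 1) • (1 : ℝ) := by simp
  rw [h1, map_smul]
  exact Submodule.smul_mem _ _ (h.tangent _ (hσb r))

/-- The integral curves of the cogeodesic field. -/
theorem exists_isLeafCurve_cogeodesic {α : CotangentBundle n M} (hα : α ∈ dualNullCone g τ) :
    ∃ γ ε, IsLeafCurve τ γ ε ∧ γ 0 = α ∧
      tanMap 𝓘(ℝ, ℝ) (cotangentModel n) γ 0 1 = g.cogeodesic α := by
  set χ := extChartAt (cotangentModel n) α with hχ
  -- Restricting the flow to the open region `α(τ) < 0` takes care of the future condition; only the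
  -- vanishing of the energy remains.
  have hOo : IsOpen (χ.target ∩ χ.symm ⁻¹' {β | τ.pairing β < 0}) :=
    (continuousOn_extChartAt_symm α).isOpen_inter_preimage (isOpen_extChartAt_target α)
      (isOpen_Iio.preimage τ.continuous_pairing)
  obtain ⟨c, hc0, ε, hε, hcs, hc⟩ := exists_contDiffOn_integralCurve hOo
    (X := g.cogeodesicInChart α) (fun y hy => g.cogeodesicInChart_contDiffAt α hy.1)
    (y₀ := χ α) ⟨mem_extChartAt_target α, by
      change τ.pairing (χ.symm (χ α)) < 0
      rw [hχ, extChartAt_to_inv]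
      exact ((mem_dualNullCone_iff τ α).1 hα).2⟩
  have hder : ∀ t ∈ Metric.ball (0 : ℝ) ε,
      tanMap 𝓘(ℝ, ℝ) (cotangentModel n) (fun t => χ.symm (c t)) t 1 =
        g.cogeodesic (χ.symm (c t)) := by
    intro t ht
    rw [tanMap_comp (mdifferentiableAt_extChartAt_symm (hc t ht).1.1)
      (hc t ht).2.differentiableAt.mdifferentiableAt, tanMap_eq_fderiv,
      ContinuousLinearMap.comp_apply, (hc t ht).2.hasFDerivAt.fderiv]
    rw [← g.tanMap_cogeodesicInChart α (hc t ht).1.1]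
    simp
  have h00 : χ.symm (c 0) = α := by rw [hc0, hχ, extChartAt_to_inv]
  -- Conservation of energy: `dE_g(X_g) = ω(X_g, X_g) = 0`.
  have hE : ∀ t ∈ Metric.ball (0 : ℝ) ε, g.energyInChart α (c t) = 0 := by
    intro t ht
    have hd : ∀ s ∈ Metric.ball (0 : ℝ) ε,
        HasDerivAt (fun s => g.energyInChart α (c s)) 0 s := by
      intro s hs
      have h1 := (((g.energyInChart_contDiffAt α (hc s hs).1.1).differentiableAt
        (by simp)).hasFDerivAt).comp_hasDerivAt s (hc s hs).2
      refine h1.congr_deriv ?_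
      have h2 := (symplecticEquiv n).apply_symm_apply (fderiv ℝ (g.energyInChart α) (c s))
      rw [← h2, symplecticEquiv_apply]
      exact sub_self _
    have h0 : g.energyInChart α (c 0) = 0 := by
      change g.energy (χ.symm (c 0)) = 0
      rw [h00]
      exact energy_eq_zero_of_mem τ hα
    rw [← h0]
    refine (convex_ball (0 : ℝ) ε).is_const_of_fderivWithin_eq_zero (𝕜 := ℝ)
      (f := fun s => g.energyInChart α (c s))
      (fun s hs => (hd s hs).differentiableAt.differentiableWithinAt) (fun s hs => ?_) ht
      (Metric.mem_ball_self hε)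
    rw [fderivWithin_of_isOpen Metric.isOpen_ball hs, (hd s hs).hasFDerivAt.fderiv]
    simp
  refine ⟨fun t => χ.symm (c t), ε, ⟨hε, fun t ht => ?_, fun t ht => ?_, fun t ht => ?_⟩, h00, ?_⟩
  · exact (contMDiffAt_extChartAt_symm (hc t ht).1.1).comp t
      (hcs.contDiffAt (Metric.isOpen_ball.mem_nhds ht)).contMDiffAt
  · exact (mem_dualNullCone_iff τ _).2 ⟨hE t ht, (hc t ht).1.2⟩
  · rw [hder t ht]
    exact Submodule.subset_span (Set.mem_insert _ _)
  · rw [hder 0 (Metric.mem_ball_self hε), h00]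

/-- The orbits of the Euler vector field. -/
theorem exists_isLeafCurve_euler {α : CotangentBundle n M} (hα : α ∈ dualNullCone g τ) :
    ∃ γ ε, IsLeafCurve τ γ ε ∧ γ 0 = α ∧
      tanMap 𝓘(ℝ, ℝ) (cotangentModel n) γ 0 1 = euler α := by
  set χ := extChartAt (cotangentModel n) α with hχ
  set y := χ α with hy
  have hyt : y ∈ χ.target := mem_extChartAt_target α
  -- The Euler flow multiplies covectors by `eᵗ`; this factor is positive, so null covectors stay
  -- null and future pointing.
  set c : ℝ → Phase n := fun t => (y.1, Real.exp t • y.2) with hc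
  have hct : ∀ t, c t ∈ χ.target := by
    intro t
    rw [hχ, cotangent_extChartAt_target] at hyt ⊢
    exact ⟨hyt.1, trivial⟩
  have hcs : ContDiff ℝ ∞ c := contDiff_const.prodMk (Real.contDiff_exp.smul contDiff_const)
  have hcd : ∀ t, HasDerivAt c (0, (c t).2) t := fun t =>
    (hasDerivAt_const t y.1).prodMk ((Real.hasDerivAt_exp t).smul_const y.2)
  have hγ : ∀ t, χ.symm (c t) = mkCov α.proj (Real.exp t • cov α) := by
    intro t
    rw [hc, ← mkCov_smul_symm α hyt, hy, hχ, extChartAt_to_inv]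
  have hder : ∀ t, tanMap 𝓘(ℝ, ℝ) (cotangentModel n) (fun t => χ.symm (c t)) t 1 =
      euler (χ.symm (c t)) := by
    intro t
    rw [tanMap_comp (mdifferentiableAt_extChartAt_symm (hct t))
      (hcd t).differentiableAt.mdifferentiableAt, tanMap_eq_fderiv,
      ContinuousLinearMap.comp_apply, (hcd t).hasFDerivAt.fderiv, euler_symm α (hct t)]
    simp
  have h00 : χ.symm (c 0) = α := by
    rw [hγ, Real.exp_zero, one_smul]
    rfl
  refine ⟨fun t => χ.symm (c t), 1, ⟨one_pos, fun t ht => ?_, fun t ht => ?_, fun t ht => ?_⟩,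
    h00, ?_⟩
  · exact (contMDiffAt_extChartAt_symm (hct t)).comp t hcs.contMDiff.contMDiffAt
  · rw [mem_dualNullCone_iff]
    obtain ⟨h1, h2⟩ := (mem_dualNullCone_iff τ α).1 hα
    constructor
    · have e1 := g.energy_symm α (hct t)
      have e2 := g.energy_symm α hyt
      rw [hy, extChartAt_to_inv, h1] at e2
      change g.energy (χ.symm (c t)) = 0
      rw [e1]
      simp only [hc, map_smul, smul_apply, hy, ← e2, smul_zero]
    · rw [hγ, TimeOrientation.pairing_mkCov]
      exact mul_neg_of_pos_of_neg (Real.exp_pos t) h2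
  · rw [hder t]
    exact Submodule.subset_span (Set.mem_insert_of_mem _ rfl)
  · rw [hder 0, h00]

end NullCone

/-! ### Local extensions of the projection and the kernel of its differential. -/

section Extension

variable {n : ℕ} {M : Type*} [TopologicalSpace M] [ChartedSpace (Euc n) M]
  [IsManifold (𝓡 n) ∞ M]

/-- The coordinate expression of a map on `T*M` in the charts at `α` and at `κ`. -/
def chartRep (k : ℕ) {N : Type*} [TopologicalSpace N] [ChartedSpace (Euc k) N]
    (F : CotangentBundle n M → N) (α : CotangentBundle n M) (κ : N) (z : Phase n) : Euc k :=
  extChartAt (𝓡 k) κ (F ((extChartAt (cotangentModel n) α).symm z))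

section

variable {k : ℕ} {N : Type*} [TopologicalSpace N] [ChartedSpace (Euc k) N] [IsManifold (𝓡 k) ∞ N]
  {F : CotangentBundle n M → N} {α : CotangentBundle n M} {κ : N} {z : Phase n}

theorem chartRep_contDiffAt (hz : z ∈ (extChartAt (cotangentModel n) α).target)
    (hF : ContMDiffAt (cotangentModel n) (𝓡 k) ∞ F ((extChartAt (cotangentModel n) α).symm z))
    (hκ : F ((extChartAt (cotangentModel n) α).symm z) ∈ (extChartAt (𝓡 k) κ).source) :
    ContDiffAt ℝ ∞ (chartRep k F α κ) z := by
  rw [← contMDiffAt_iff_contDiffAt]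
  exact (contMDiffAt_extChartAt' (by simpa using hκ)).comp z
    (hF.comp z (contMDiffAt_extChartAt_symm hz))

theorem fderiv_chartRep (hz : z ∈ (extChartAt (cotangentModel n) α).target)
    (hF : ContMDiffAt (cotangentModel n) (𝓡 k) ∞ F ((extChartAt (cotangentModel n) α).symm z))
    (hκ : F ((extChartAt (cotangentModel n) α).symm z) ∈ (extChartAt (𝓡 k) κ).source)
    (v : Phase n) :
    fderiv ℝ (chartRep k F α κ) z v = tanMap (𝓡 k) 𝓘(ℝ, Euc k) (extChartAt (𝓡 k) κ)
      (F ((extChartAt (cotangentModel n) α).symm z))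
      (tanMap (cotangentModel n) (𝓡 k) F ((extChartAt (cotangentModel n) α).symm z)
        (tanMap 𝓘(ℝ, Phase n) (cotangentModel n) (extChartAt (cotangentModel n) α).symm z v)) := by
  have h1 : MDifferentiableAt 𝓘(ℝ, Phase n) (𝓡 k)
      (fun z => F ((extChartAt (cotangentModel n) α).symm z)) z :=
    (hF.mdifferentiableAt (by simp)).comp z (mdifferentiableAt_extChartAt_symm hz)
  rw [← tanMap_eq_fderiv]
  unfold chartRep
  rw [tanMap_comp (g := extChartAt (𝓡 k) κ)
    (f := fun z => F ((extChartAt (cotangentModel n) α).symm z))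
    (mdifferentiableAt_extChartAt_of_mem_source hκ) h1,
    tanMap_comp (hF.mdifferentiableAt (by simp)) (mdifferentiableAt_extChartAt_symm hz)]
  rfl

end

variable {g : LorentzianMetric n M} {τ : TimeOrientation g}
  [ChartedSpace (Euc (2 * n - 3)) (NullGeodesicSpace g τ)]

/-- The differential of an extension of the projection to the leaf space. -/
def extDiff (F : CotangentBundle n M → NullGeodesicSpace g τ) (α : CotangentBundle n M) :
    Phase n →L[ℝ] Euc (2 * n - 3) :=
  tanMap (cotangentModel n) (𝓡 (2 * n - 3)) F α

/-- An extension at `α` serves at all nearby null covectors too, so one `F` can be followed along a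
short piece of a curve. -/
theorem IsLocalExtension.exists_nhd {α : dualNullCone g τ}
    {F : CotangentBundle n M → NullGeodesicSpace g τ} (h : IsLocalExtension g τ α F) :
    ∃ U : Set (CotangentBundle n M), IsOpen U ∧ (α : CotangentBundle n M) ∈ U ∧ ∀ β ∈ U,
      ContMDiffAt (cotangentModel n) (𝓡 (2 * n - 3)) ∞ F β ∧
      ∀ hβ : β ∈ dualNullCone g τ, F β = toLeaf g τ ⟨β, hβ⟩ ∧ IsLocalExtension g τ ⟨β, hβ⟩ F := by
  obtain ⟨U, hU, hα, hF, hF2⟩ := h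
  exact ⟨U, hU, hα, fun β hβ => ⟨hF.contMDiffAt (hU.mem_nhds hβ), fun hβ2 =>
    ⟨hF2 ⟨β, hβ2⟩ hβ, U, hU, hβ, hF, hF2⟩⟩⟩

theorem IsLocalExtension.contMDiffAt {α : dualNullCone g τ}
    {F : CotangentBundle n M → NullGeodesicSpace g τ} (h : IsLocalExtension g τ α F) :
    ContMDiffAt (cotangentModel n) (𝓡 (2 * n - 3)) ∞ F α := by
  obtain ⟨U, -, hα, hF⟩ := h.exists_nhd
  exact (hF α hα).1

theorem IsLocalExtension.apply_eq {α : dualNullCone g τ}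
    {F : CotangentBundle n M → NullGeodesicSpace g τ} (h : IsLocalExtension g τ α F) :
    F α = toLeaf g τ α := by
  obtain ⟨U, -, hα, hF⟩ := h.exists_nhd
  exact ((hF α hα).2 α.2).1

/-- `F` agrees with the projection on the cone, and the projection is constant along a leaf curve.
-/
theorem IsLocalExtension.extDiff_leafCurve {α : dualNullCone g τ}
    {F : CotangentBundle n M → NullGeodesicSpace g τ} (h : IsLocalExtension g τ α F)
    {γ : ℝ → CotangentBundle n M} {ε : ℝ} (hγ : IsLeafCurve τ γ ε) (h0 : γ 0 = α) :
    extDiff F α (tanMap 𝓘(ℝ, ℝ) (cotangentModel n) γ 0 1) = 0 := by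
  obtain ⟨U, hU, hα, hF⟩ := h.exists_nhd
  have hc := hγ.contMDiffAt 0 (Metric.mem_ball_self hγ.pos)
  have h1 : (fun t => F (γ t)) =ᶠ[𝓝 0] fun _ => toLeaf g τ α := by
    filter_upwards [hc.continuousAt.eventually (hU.mem_nhds (by rwa [h0])),
      Metric.ball_mem_nhds (0 : ℝ) hγ.pos] with t ht ht2
    rw [((hF _ ht).2 (hγ.mem t ht2)).1, hγ.toLeaf_eq ht2]
    congr 1
    exact Subtype.ext h0
  have h2 := h1.tanMap_eq (I := 𝓘(ℝ, ℝ)) (I' := 𝓡 (2 * n - 3))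
  have h3 : MDifferentiableAt (cotangentModel n) (𝓡 (2 * n - 3)) F (γ 0) := by
    rw [h0]; exact h.contMDiffAt.mdifferentiableAt (by simp)
  rw [tanMap_const, tanMap_comp h3 (hc.mdifferentiableAt (by simp)), h0] at h2
  exact DFunLike.congr_fun h2 1

theorem IsLocalExtension.extDiff_cogeodesic {α : dualNullCone g τ}
    {F : CotangentBundle n M → NullGeodesicSpace g τ} (h : IsLocalExtension g τ α F) :
    extDiff F α (g.cogeodesic α) = 0 := by
  obtain ⟨γ, ε, hγ, h0, h1⟩ := exists_isLeafCurve_cogeodesic α.2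
  rw [← h1]
  exact h.extDiff_leafCurve hγ h0

theorem IsLocalExtension.extDiff_euler {α : dualNullCone g τ}
    {F : CotangentBundle n M → NullGeodesicSpace g τ} (h : IsLocalExtension g τ α F) :
    extDiff F α (euler (α : CotangentBundle n M)) = 0 := by
  obtain ⟨γ, ε, hγ, h0, h1⟩ := exists_isLeafCurve_euler α.2
  rw [← h1]
  exact h.extDiff_leafCurve hγ h0

variable [IsManifold (𝓡 (2 * n - 3)) ∞ (NullGeodesicSpace g τ)]

theorem fderiv_chartRep_self {α : dualNullCone g τ}
    {F : CotangentBundle n M → NullGeodesicSpace g τ} (h : IsLocalExtension g τ α F) (v : Phase n) :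
    fderiv ℝ (chartRep (2 * n - 3) F α (toLeaf g τ α))
      (extChartAt (cotangentModel n) (α : CotangentBundle n M) α) v = extDiff F α v := by
  have h1 := h.contMDiffAt
  rw [← extChartAt_to_inv (I := cotangentModel n) (α : CotangentBundle n M)] at h1
  rw [fderiv_chartRep (mem_extChartAt_target _) h1 (by
    rw [extChartAt_to_inv, h.apply_eq]; exact mem_extChartAt_source _), extChartAt_to_inv,
    tanMap_extChartAt_symm_self, h.apply_eq, tanMap_extChartAt_self]
  rfl

theorem chartRep_contDiffAt_self {α : dualNullCone g τ}
    {F : CotangentBundle n M → NullGeodesicSpace g τ} (h : IsLocalExtension g τ α F) :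
    ContDiffAt ℝ ∞ (chartRep (2 * n - 3) F α (toLeaf g τ α))
      (extChartAt (cotangentModel n) (α : CotangentBundle n M) α) := by
  have h1 := h.contMDiffAt
  rw [← extChartAt_to_inv (I := cotangentModel n) (α : CotangentBundle n M)] at h1
  exact chartRep_contDiffAt (mem_extChartAt_target _) h1 (by
    rw [extChartAt_to_inv, h.apply_eq]; exact mem_extChartAt_source _)

theorem fderiv_energyInChart_self (α : CotangentBundle n M) :
    fderiv ℝ (g.energyInChart α) (extChartAt (cotangentModel n) α α) = g.energyDeriv α := by
  rw [← g.tanMap_energy_symm α (mem_extChartAt_target α), extChartAt_to_inv,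
    tanMap_extChartAt_symm_self, ContinuousLinearMap.comp_id]
  rfl

theorem tendsto_extChartAt_symm (α : CotangentBundle n M) :
    Filter.Tendsto (extChartAt (cotangentModel n) α).symm
      (𝓝 (extChartAt (cotangentModel n) α α)) (𝓝 α) := by
  have := (continuousAt_extChartAt_symm (I := cotangentModel n) α).tendsto
  rwa [extChartAt_to_inv] at this

/-- The differential of the projection to the leaf space along the null cone does not depend on
the extension. -/
theorem IsLocalExtension.extDiff_eq {α : dualNullCone g τ}
    {F F' : CotangentBundle n M → NullGeodesicSpace g τ} (h : IsLocalExtension g τ α F)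
    (h' : IsLocalExtension g τ α F') {v : Phase n}
    (hv : g.energyDeriv (α : CotangentBundle n M) v = 0) : extDiff F α v = extDiff F' α v := by
  obtain ⟨U, hU, hα, hF⟩ := h.exists_nhd
  obtain ⟨U', hU', hα', hF'⟩ := h'.exists_nhd
  have hE := (g.energyInChart_contDiffAt (α : CotangentBundle n M)
    (mem_extChartAt_target _)).hasStrictFDerivAt (by simp)
  rw [fderiv_energyInChart_self] at hE
  have h1 := ((chartRep_contDiffAt_self h).sub (chartRep_contDiffAt_self h')).hasStrictFDerivAt
    (by simp)
  have hev : ∀ᶠ β in 𝓝 (α : CotangentBundle n M), β ∈ U ∧ β ∈ U' ∧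
      (g.energy β = 0 → β ∈ dualNullCone g τ) := by
    filter_upwards [hU.mem_nhds hα, hU'.mem_nhds hα', eventually_mem_dualNullCone τ α.2]
      with β h1 h2 h3 using ⟨h1, h2, h3⟩
  have h2 := hE.apply_eq_zero_of_eqOn_levelSet
    (g.energyDeriv_ne_zero _ (cov_ne_zero_of_mem τ α.2)) h1 (by
      filter_upwards [(tendsto_extChartAt_symm (α : CotangentBundle n M)).eventually hev]
        with z hz hzE
      obtain ⟨hz1, hz2, hz3⟩ := hz
      have hz4 : (extChartAt (cotangentModel n) (α : CotangentBundle n M)).symm z ∈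
          dualNullCone g τ := by
        apply hz3
        refine hzE.trans ?_
        rw [LorentzianMetric.energyInChart, extChartAt_to_inv]
        exact energy_eq_zero_of_mem τ α.2
      simp only [chartRep, extChartAt_to_inv]
      rw [((hF _ hz1).2 hz4).1, ((hF' _ hz2).2 hz4).1, h.apply_eq, h'.apply_eq, sub_self,
        sub_self]) hv
  have h3 := (((chartRep_contDiffAt_self h).differentiableAt (by simp)).hasFDerivAt.sub
    ((chartRep_contDiffAt_self h').differentiableAt (by simp)).hasFDerivAt).fderiv
  erw [h3] at h2
  rw [sub_apply, fderiv_chartRep_self h, fderiv_chartRep_self h'] at h2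
  exact sub_eq_zero.1 h2

/-- The hypothesis provides surjectivity for one extension at each point; independence of the
extension transfers it to all. -/
theorem IsLocalExtension.exists_extDiff_eq (hdesc : SmoothStructureDescends g τ)
    {α : dualNullCone g τ} {F : CotangentBundle n M → NullGeodesicSpace g τ}
    (h : IsLocalExtension g τ α F) (u : Euc (2 * n - 3)) :
    ∃ v : Phase n, g.energyDeriv (α : CotangentBundle n M) v = 0 ∧ extDiff F α v = u := by
  obtain ⟨F', hF', hs⟩ := hdesc α
  obtain ⟨v, hv, hvu⟩ := hs u
  exact ⟨v, hv, (h.extDiff_eq hF' hv).trans hvu⟩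

/-- `(dE_g, dF)` maps a space of dimension `2n` onto one of dimension `2n - 2`, so its kernel is a
plane. It contains the independent vectors `X_g` and `ξ`. -/
theorem IsLocalExtension.exists_eq_of_extDiff_eq_zero (hn : 2 ≤ n)
    (hdesc : SmoothStructureDescends g τ)
    {α : dualNullCone g τ} {F : CotangentBundle n M → NullGeodesicSpace g τ}
    (h : IsLocalExtension g τ α F) {v : Phase n}
    (hv : g.energyDeriv (α : CotangentBundle n M) v = 0) (hFv : extDiff F α v = 0) :
    ∃ a b : ℝ, v = a • g.cogeodesic (α : CotangentBundle n M) +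
      b • euler (α : CotangentBundle n M) := by
  have hα := cov_ne_zero_of_mem τ α.2
  refine exists_eq_add_smul_of_surjective (((g.energyDeriv (α : CotangentBundle n M)).prod
    (extDiff F α) : Phase n →L[ℝ] ℝ × Euc (2 * n - 3)) : Phase n →ₗ[ℝ] ℝ × Euc (2 * n - 3)) ?_ ?_
    (g.cogeodesic_euler_linearIndependent _ hα) ?_ ?_ ?_
  · rintro ⟨r, u⟩
    obtain ⟨p, hp⟩ := g.exists_energyDeriv_vertical_ne_zero _ hα
    set w : Phase n := (r / g.energyDeriv (α : CotangentBundle n M) (0, p)) • (0, p) with hw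
    obtain ⟨v, hv, hvu⟩ := h.exists_extDiff_eq hdesc (u - extDiff F α w)
    refine ⟨w + v, Prod.ext ?_ ?_⟩
    · change g.energyDeriv (α : CotangentBundle n M) (w + v) = r
      rw [map_add, hv, add_zero, hw, map_smul, smul_eq_mul, div_mul_cancel₀ _ hp]
    · change extDiff F α (w + v) = u
      rw [map_add, hvu]
      abel
  · rw [finrank_phase, Module.finrank_prod, Module.finrank_self, finrank_euclideanSpace,
      Fintype.card_fin]
    -- The count is `2n = 1 + (2n - 3) + 2`; `2 ≤ n` ensures that the natural number subtraction is
    -- not truncated.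
    omega
  · exact Prod.ext (g.energyDeriv_cogeodesic _) h.extDiff_cogeodesic
  · refine Prod.ext ?_ h.extDiff_euler
    change g.energyDeriv _ (euler _) = 0
    rw [g.energyDeriv_euler, energy_eq_zero_of_mem τ α.2, mul_zero]
  · exact Prod.ext hv hFv

/-- Both `θ(X_g) = 2 E_g` and `θ(ξ)` vanish on the cone. -/
theorem IsLocalExtension.liouville_eq_zero (hn : 2 ≤ n) (hdesc : SmoothStructureDescends g τ)
    {α : dualNullCone g τ} {F : CotangentBundle n M → NullGeodesicSpace g τ}
    (h : IsLocalExtension g τ α F) {v : Phase n}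
    (hv : g.energyDeriv (α : CotangentBundle n M) v = 0) (hFv : extDiff F α v = 0) :
    liouville (α : CotangentBundle n M) v = 0 := by
  obtain ⟨a, b, rfl⟩ := h.exists_eq_of_extDiff_eq_zero hn hdesc hv hFv
  rw [map_add, map_smul, map_smul, g.liouville_cogeodesic, LorentzianMetric.liouville_euler,
    energy_eq_zero_of_mem τ α.2]
  simp

end Extension

/-! ### The induced subspace, its invariance along leaves, existence and uniqueness of `D`. -/

section Invariance

variable {n : ℕ} {M : Type*} [TopologicalSpace M] [ChartedSpace (Euc n) M]
  [IsManifold (𝓡 n) ∞ M] {g : LorentzianMetric n M} {τ : TimeOrientation g}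
  [ChartedSpace (Euc (2 * n - 3)) (NullGeodesicSpace g τ)]
  [IsManifold (𝓡 (2 * n - 3)) ∞ (NullGeodesicSpace g τ)]

/-- The coordinate expression of the energy and of an extension of the projection. -/
def energyRep (F : CotangentBundle n M → NullGeodesicSpace g τ) (α : CotangentBundle n M)
    (κ : NullGeodesicSpace g τ) (z : Phase n) : ℝ × Euc (2 * n - 3) :=
  (g.energyInChart α z, chartRep (2 * n - 3) F α κ z)

variable {F : CotangentBundle n M → NullGeodesicSpace g τ} {α : CotangentBundle n M}
  {κ : NullGeodesicSpace g τ} {z : Phase n}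

theorem energyRep_contDiffAt (hz : z ∈ (extChartAt (cotangentModel n) α).target)
    (hF : ContMDiffAt (cotangentModel n) (𝓡 (2 * n - 3)) ∞ F
      ((extChartAt (cotangentModel n) α).symm z))
    (hκ : F ((extChartAt (cotangentModel n) α).symm z) ∈ (extChartAt (𝓡 (2 * n - 3)) κ).source) :
    ContDiffAt ℝ ∞ (energyRep F α κ) z :=
  (g.energyInChart_contDiffAt α hz).prodMk (chartRep_contDiffAt hz hF hκ)

theorem fderiv_energyRep (hz : z ∈ (extChartAt (cotangentModel n) α).target)
    (hF : ContMDiffAt (cotangentModel n) (𝓡 (2 * n - 3)) ∞ F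
      ((extChartAt (cotangentModel n) α).symm z))
    (hκ : F ((extChartAt (cotangentModel n) α).symm z) ∈ (extChartAt (𝓡 (2 * n - 3)) κ).source)
    (v : Phase n) :
    fderiv ℝ (energyRep F α κ) z v =
      (g.energyDeriv ((extChartAt (cotangentModel n) α).symm z)
        (tanMap 𝓘(ℝ, Phase n) (cotangentModel n) (extChartAt (cotangentModel n) α).symm z v),
      tanMap (𝓡 (2 * n - 3)) 𝓘(ℝ, Euc (2 * n - 3)) (extChartAt (𝓡 (2 * n - 3)) κ)
        (F ((extChartAt (cotangentModel n) α).symm z))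
        (extDiff F ((extChartAt (cotangentModel n) α).symm z)
        (tanMap 𝓘(ℝ, Phase n) (cotangentModel n) (extChartAt (cotangentModel n) α).symm z v))) := by
  have h1 := ((g.energyInChart_contDiffAt α hz).differentiableAt (by simp)).hasFDerivAt.prodMk
    ((chartRep_contDiffAt hz hF hκ).differentiableAt (by simp)).hasFDerivAt
  have h2 : fderiv ℝ (energyRep F α κ) z = _ := h1.fderiv
  rw [h2]
  refine Prod.ext ?_ ?_
  · change fderiv ℝ (g.energyInChart α) z v = _
    rw [← g.tanMap_energy_symm α hz]
    rfl
  · exact fderiv_chartRep hz hF hκ v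

theorem fderiv_energyRep_self {α : dualNullCone g τ} (h : IsLocalExtension g τ α F) (v : Phase n) :
    fderiv ℝ (energyRep F α (toLeaf g τ α))
      (extChartAt (cotangentModel n) (α : CotangentBundle n M) α) v =
        (g.energyDeriv (α : CotangentBundle n M) v, extDiff F α v) := by
  have h1 := h.contMDiffAt
  rw [← extChartAt_to_inv (I := cotangentModel n) (α : CotangentBundle n M)] at h1
  rw [fderiv_energyRep (mem_extChartAt_target _) h1 (by
    rw [extChartAt_to_inv, h.apply_eq]; exact mem_extChartAt_source _), extChartAt_to_inv,
    tanMap_extChartAt_symm_self, h.apply_eq, tanMap_extChartAt_self]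
  rfl

/-- A vertical vector produces the required energy component, and vectors tangent to the cone then
adjust the rest. -/
theorem fderiv_energyRep_surjective (hdesc : SmoothStructureDescends g τ) {α : dualNullCone g τ}
    (h : IsLocalExtension g τ α F) :
    Function.Surjective (fderiv ℝ (energyRep F α (toLeaf g τ α))
      (extChartAt (cotangentModel n) (α : CotangentBundle n M) α)) := by
  rintro ⟨r, u⟩
  obtain ⟨p, hp⟩ := g.exists_energyDeriv_vertical_ne_zero _ (cov_ne_zero_of_mem τ α.2)
  set w : Phase n := (r / g.energyDeriv (α : CotangentBundle n M) (0, p)) • (0, p) with hw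
  obtain ⟨v, hv, hvu⟩ := h.exists_extDiff_eq hdesc (u - extDiff F α w)
  refine ⟨w + v, ?_⟩
  rw [fderiv_energyRep_self h]
  refine Prod.ext ?_ ?_
  · rw [map_add, hv, add_zero, hw, map_smul, smul_eq_mul, div_mul_cancel₀ _ hp]
  · change extDiff F α (w + v) = u
    rw [map_add, hvu]
    abel

/-- The subspace of the tangent space of the leaf space induced by `ker θ` at a point of the null
cone. -/
def leafKernel (hdesc : SmoothStructureDescends g τ) (α : dualNullCone g τ) :
    Submodule ℝ (Euc (2 * n - 3)) :=
  ((g.energyDeriv (α : CotangentBundle n M)).ker ⊓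
    (liouville (α : CotangentBundle n M)).ker).map
      (extDiff (hdesc α).choose α : Phase n →ₗ[ℝ] Euc (2 * n - 3))

theorem mem_leafKernel_iff_exists (hdesc : SmoothStructureDescends g τ) {α : dualNullCone g τ}
    (h : IsLocalExtension g τ α F) (u : Euc (2 * n - 3)) :
    u ∈ leafKernel hdesc α ↔ ∃ v : Phase n, g.energyDeriv (α : CotangentBundle n M) v = 0 ∧
      liouville (α : CotangentBundle n M) v = 0 ∧ extDiff F α v = u := by
  have h' : IsLocalExtension g τ α (hdesc α).choose := (hdesc α).choose_spec.1
  rw [leafKernel, Submodule.mem_map]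
  constructor
  · rintro ⟨v, ⟨hv1, hv2⟩, hv3⟩
    exact ⟨v, hv1, hv2, (h.extDiff_eq h' hv1).trans hv3⟩
  · rintro ⟨v, hv1, hv2, hv3⟩
    exact ⟨v, ⟨hv1, hv2⟩, (h'.extDiff_eq h hv1).trans hv3⟩

/-- Two tangent vectors with the same image differ by an element of `ker dp`, where `θ` vanishes; so
the image of `ker θ` has no larger preimage. -/
theorem extDiff_mem_leafKernel_iff (hn : 2 ≤ n) (hdesc : SmoothStructureDescends g τ)
    {α : dualNullCone g τ} (h : IsLocalExtension g τ α F) {v : Phase n}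
    (hv : g.energyDeriv (α : CotangentBundle n M) v = 0) :
    extDiff F α v ∈ leafKernel hdesc α ↔ liouville (α : CotangentBundle n M) v = 0 := by
  rw [mem_leafKernel_iff_exists hdesc h]
  constructor
  · rintro ⟨w, hw1, hw2, hw3⟩
    have h1 := h.liouville_eq_zero hn hdesc (v := v - w) (by rw [map_sub, hv, hw1, sub_self])
      (by rw [map_sub, hw3, sub_self])
    rwa [map_sub, hw2, sub_zero] at h1
  · exact fun h1 => ⟨v, hv, h1, rfl⟩

/-- A curve tangent to the null distribution stays in a leaf. -/
theorem toLeaf_eq_of_tangentCurve {c : ℝ → CotangentBundle n M}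
    (hcs : ContMDiff 𝓘(ℝ, ℝ) (cotangentModel n) ∞ c) (hc : ∀ t, c t ∈ dualNullCone g τ)
    (hct : ∀ t, tanMap 𝓘(ℝ, ℝ) (cotangentModel n) c t 1 ∈ nullDist g (c t)) (t : ℝ) :
    toLeaf g τ ⟨c t, hc t⟩ = toLeaf g τ ⟨c 0, hc 0⟩ :=
  IsLeafCurve.toLeaf_eq (ε := |t| + 1) ⟨by positivity, fun s _ => hcs s, fun s _ => hc s,
    fun s _ => hct s⟩ (by simp)

/-! ### The transport equation in canonical coordinates. -/

section Transport

variable {α : CotangentBundle n M} {z : Phase n}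

theorem IsLocalExtension.canonicalOneForm_eq_zero (hn : 2 ≤ n)
    (hdesc : SmoothStructureDescends g τ) (hz : z ∈ (extChartAt (cotangentModel n) α).target)
    (hβ : (extChartAt (cotangentModel n) α).symm z ∈ dualNullCone g τ)
    (h : IsLocalExtension g τ ⟨_, hβ⟩ F)
    (hκ : F ((extChartAt (cotangentModel n) α).symm z) ∈ (extChartAt (𝓡 (2 * n - 3)) κ).source)
    {v : Phase n} (hv : fderiv ℝ (energyRep F α κ) z v = 0) : canonicalOneForm n z v = 0 := by
  rw [fderiv_energyRep hz h.contMDiffAt hκ, Prod.mk_eq_zero] at hv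
  have e1 := (extChartAt (𝓡 (2 * n - 3)) κ).map_source hκ
  have e2 := tanMap_symm_tanMap_extChartAt (I := 𝓡 (2 * n - 3)) e1 (extDiff F
    ((extChartAt (cotangentModel n) α).symm z) (tanMap 𝓘(ℝ, Phase n) (cotangentModel n)
      (extChartAt (cotangentModel n) α).symm z v))
  rw [(extChartAt (𝓡 (2 * n - 3)) κ).left_inv hκ, hv.2, map_zero] at e2
  have e3 := h.liouville_eq_zero hn hdesc hv.1 e2.symm
  rw [canonicalOneForm_apply, ← liouville_tanMap_symm α hz]
  exact e3

/-- In coordinates, vectors of the null distribution are characteristic for `p dq` on the level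
set of the energy. -/
theorem IsLocalExtension.fderiv_energyRep_of_mem_nullDist
    (hz : z ∈ (extChartAt (cotangentModel n) α).target)
    (hβ : (extChartAt (cotangentModel n) α).symm z ∈ dualNullCone g τ)
    (h : IsLocalExtension g τ ⟨_, hβ⟩ F)
    (hκ : F ((extChartAt (cotangentModel n) α).symm z) ∈ (extChartAt (𝓡 (2 * n - 3)) κ).source)
    {v : Phase n} (hv : tanMap 𝓘(ℝ, Phase n) (cotangentModel n)
      (extChartAt (cotangentModel n) α).symm z v ∈
        nullDist g ((extChartAt (cotangentModel n) α).symm z)) :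
    fderiv ℝ (energyRep F α κ) z v = 0 ∧ ∃ b : ℝ, ∀ w, (fderiv ℝ (energyRep F α κ) z w).1 = 0 →
      fderiv ℝ (canonicalOneForm n) z v w - fderiv ℝ (canonicalOneForm n) z w v =
        b * canonicalOneForm n z w := by
  obtain ⟨a, b, hab⟩ := Submodule.mem_span_pair.1 hv
  have hE := energy_eq_zero_of_mem τ hβ
  -- The factor is the Euler coefficient: for `v = a X_g + b ξ` one has `dθ(v, w) = -a dE_g(w) + b
  -- θ(w)`, and `dE_g(w) = 0`.
  refine ⟨?_, b, fun w hw => ?_⟩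
  · have h1 : g.energyDeriv ((extChartAt (cotangentModel n) α).symm z)
        (tanMap 𝓘(ℝ, Phase n) (cotangentModel n) (extChartAt (cotangentModel n) α).symm z v) =
          0 := by
      rw [← hab, map_add, map_smul, map_smul, g.energyDeriv_euler, g.energyDeriv_cogeodesic, hE]
      simp
    have h2 : extDiff F ((extChartAt (cotangentModel n) α).symm z)
        (tanMap 𝓘(ℝ, Phase n) (cotangentModel n) (extChartAt (cotangentModel n) α).symm z v) =
          0 := by
      rw [← hab, map_add, map_smul, map_smul, h.extDiff_cogeodesic, h.extDiff_euler, smul_zero,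
        smul_zero, add_zero]
    rw [fderiv_energyRep hz h.contMDiffAt hκ, h1, h2, map_zero]
    rfl
  · rw [fderiv_energyRep hz h.contMDiffAt hκ] at hw
    have e1 := formDeriv_liouville_tanMap_symm α hz v w
    have e2 := liouville_tanMap_symm α hz w
    have e3 := symplecticEquiv_apply (tanMap 𝓘(ℝ, Phase n) (cotangentModel n)
      (extChartAt (cotangentModel n) α).symm z v) (tanMap 𝓘(ℝ, Phase n) (cotangentModel n)
      (extChartAt (cotangentModel n) α).symm z w)
    rw [formDeriv_liouville] at e1
    have e4 : symplecticEquiv n (tanMap 𝓘(ℝ, Phase n) (cotangentModel n)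
      (extChartAt (cotangentModel n) α).symm z v) (tanMap 𝓘(ℝ, Phase n) (cotangentModel n)
      (extChartAt (cotangentModel n) α).symm z w) = - (b * z.2 w.1) := by
      rw [← hab, map_add, map_smul, map_smul, g.symplecticEquiv_cogeodesic,
        LorentzianMetric.symplecticEquiv_euler, add_apply, smul_apply, smul_apply, neg_apply, e2]
      have hw' : g.energyDeriv ((extChartAt (cotangentModel n) α).symm z)
        (tanMap 𝓘(ℝ, Phase n) (cotangentModel n) (extChartAt (cotangentModel n) α).symm z w) =
          0 := hw
      rw [hw']
      simp
    have e5 : fderiv ℝ (canonicalOneForm n) z = canonicalOneForm n :=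
      (canonicalOneForm n).hasFDerivAt.fderiv
    rw [e5, canonicalOneForm_apply, canonicalOneForm_apply, canonicalOneForm_apply]
    linarith

theorem IsLocalExtension.fderiv_energyRep_extChartAt {β : CotangentBundle n M}
    (hβ : β ∈ dualNullCone g τ) (h : IsLocalExtension g τ ⟨β, hβ⟩ F)
    (hs : β ∈ (extChartAt (cotangentModel n) α).source)
    (hκ : F β ∈ (extChartAt (𝓡 (2 * n - 3)) κ).source)
    {v : Phase n} (hv : tanMap 𝓘(ℝ, Phase n) (cotangentModel n)
      (extChartAt (cotangentModel n) α).symm (extChartAt (cotangentModel n) α β) v ∈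
        nullDist g β) :
    fderiv ℝ (energyRep F α κ) (extChartAt (cotangentModel n) α β) v = 0 ∧ ∃ b : ℝ, ∀ w,
      (fderiv ℝ (energyRep F α κ) (extChartAt (cotangentModel n) α β) w).1 = 0 →
      fderiv ℝ (canonicalOneForm n) (extChartAt (cotangentModel n) α β) v w -
        fderiv ℝ (canonicalOneForm n) (extChartAt (cotangentModel n) α β) w v =
          b * canonicalOneForm n (extChartAt (cotangentModel n) α β) w := by
  obtain ⟨z, hz, rfl⟩ : ∃ z ∈ (extChartAt (cotangentModel n) α).target,
      (extChartAt (cotangentModel n) α).symm z = β :=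
    ⟨_, (extChartAt (cotangentModel n) α).map_source hs,
      (extChartAt (cotangentModel n) α).left_inv hs⟩
  rw [(extChartAt (cotangentModel n) α).right_inv hz] at hv ⊢
  exact h.fderiv_energyRep_of_mem_nullDist hz hβ hκ hv

theorem tanMap_symm_deriv {c : ℝ → CotangentBundle n M}
    (hcs : ContMDiff 𝓘(ℝ, ℝ) (cotangentModel n) ∞ c) {t : ℝ}
    (ht : c t ∈ (extChartAt (cotangentModel n) α).source) :
    ∃ y', HasDerivAt (fun s => extChartAt (cotangentModel n) α (c s)) y' t ∧
      tanMap 𝓘(ℝ, Phase n) (cotangentModel n) (extChartAt (cotangentModel n) α).symm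
        (extChartAt (cotangentModel n) α (c t)) y' =
          tanMap 𝓘(ℝ, ℝ) (cotangentModel n) c t 1 := by
  have hys : ContDiffAt ℝ ∞ (fun s => extChartAt (cotangentModel n) α (c s)) t := by
    rw [← contMDiffAt_iff_contDiffAt]
    exact (contMDiffAt_extChartAt' (by simpa using ht)).comp t (hcs t)
  have hyd := (hys.differentiableAt (by simp)).hasDerivAt
  refine ⟨_, hyd, ?_⟩
  have e1 : c =ᶠ[𝓝 t] fun s => (extChartAt (cotangentModel n) α).symm
      (extChartAt (cotangentModel n) α (c s)) := by
    filter_upwards [(hcs t).continuousAt.eventually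
      ((isOpen_extChartAt_source α).mem_nhds ht)] with s hs
    exact ((extChartAt (cotangentModel n) α).left_inv hs).symm
  rw [e1.tanMap_eq, tanMap_comp (g := (extChartAt (cotangentModel n) α).symm)
    (f := fun s => extChartAt (cotangentModel n) α (c s))
    (mdifferentiableAt_extChartAt_symm ((extChartAt (cotangentModel n) α).map_source ht))
    (hys.differentiableAt (by simp)).mdifferentiableAt, tanMap_eq_fderiv,
    ContinuousLinearMap.comp_apply, hyd.hasFDerivAt.fderiv]
  simp

/-- The kernel of `θ` at two points of a leaf agrees as soon as it does in coordinates. -/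
theorem leafKernel_eq_of_coordinates (hdesc : SmoothStructureDescends g τ) {α β : dualNullCone g τ}
    (h : IsLocalExtension g τ α F) (h' : IsLocalExtension g τ β F)
    (hβ : (β : CotangentBundle n M) ∈
      (extChartAt (cotangentModel n) (α : CotangentBundle n M)).source)
    (hαβ : toLeaf g τ β = toLeaf g τ α)
    (hker : ∀ v₀ v u, fderiv ℝ (energyRep F α (toLeaf g τ α))
        (extChartAt (cotangentModel n) (α : CotangentBundle n M) α) v₀ = (0, u) →
      fderiv ℝ (energyRep F α (toLeaf g τ α))
        (extChartAt (cotangentModel n) (α : CotangentBundle n M) β) v = (0, u) →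
      (canonicalOneForm n (extChartAt (cotangentModel n) (α : CotangentBundle n M) β) v = 0 ↔
        canonicalOneForm n (extChartAt (cotangentModel n) (α : CotangentBundle n M) α) v₀ = 0)) :
    leafKernel hdesc β = leafKernel hdesc α := by
  have hyt := (extChartAt (cotangentModel n) (α : CotangentBundle n M)).map_source hβ
  have hinv := (extChartAt (cotangentModel n) (α : CotangentBundle n M)).left_inv hβ
  have hFs : ContMDiffAt (cotangentModel n) (𝓡 (2 * n - 3)) ∞ F
      ((extChartAt (cotangentModel n) (α : CotangentBundle n M)).symm
        (extChartAt (cotangentModel n) (α : CotangentBundle n M) β)) := by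
    rw [hinv]; exact h'.contMDiffAt
  have hκt : F β = toLeaf g τ α := h'.apply_eq.trans hαβ
  have hκs : F ((extChartAt (cotangentModel n) (α : CotangentBundle n M)).symm
        (extChartAt (cotangentModel n) (α : CotangentBundle n M) β)) ∈
          (extChartAt (𝓡 (2 * n - 3)) (toLeaf g τ α)).source := by
    rw [hinv, hκt]; exact mem_extChartAt_source _
  have key : ∀ v₀ v : Phase n, g.energyDeriv (α : CotangentBundle n M) v₀ = 0 →
      g.energyDeriv (β : CotangentBundle n M) v = 0 → extDiff F α v₀ = extDiff F β v →
      (liouville (β : CotangentBundle n M) v = 0 ↔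
        liouville (α : CotangentBundle n M) v₀ = 0) := by
    intro v₀ v hv₀ hv huv
    have e1 := tanMap_symm_tanMap_extChartAt (I := cotangentModel n) hyt v
    rw [hinv] at e1
    have e2 := hker v₀ (tanMap (cotangentModel n) 𝓘(ℝ, Phase n)
      (extChartAt (cotangentModel n) (α : CotangentBundle n M)) β v) (extDiff F β v)
      ((fderiv_energyRep_self h v₀).trans (Prod.ext hv₀ huv)) (by
        rw [fderiv_energyRep hyt hFs hκs, hinv, e1, hv, hκt, tanMap_extChartAt_self]
        rfl)
    have e3 := liouville_tanMap_symm (α : CotangentBundle n M) hyt (tanMap (cotangentModel n)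
      𝓘(ℝ, Phase n) (extChartAt (cotangentModel n) (α : CotangentBundle n M)) β v)
    have e4 := liouville_tanMap_symm (α : CotangentBundle n M)
      (mem_extChartAt_target (α : CotangentBundle n M)) v₀
    rw [extChartAt_to_inv, tanMap_extChartAt_symm_self, ContinuousLinearMap.id_apply] at e4
    rw [hinv, e1] at e3
    rw [e3, e4]
    exact e2
  ext u
  rw [mem_leafKernel_iff_exists hdesc h, mem_leafKernel_iff_exists hdesc h']
  constructor
  · rintro ⟨v, hv1, hv2, hv3⟩
    obtain ⟨v₀, hv₀, hv₀u⟩ := h.exists_extDiff_eq hdesc u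
    exact ⟨v₀, hv₀, (key v₀ v hv₀ hv1 (hv₀u.trans hv3.symm)).1 hv2, hv₀u⟩
  · rintro ⟨v₀, hv1, hv2, hv3⟩
    obtain ⟨v, hv, hvu⟩ := h'.exists_extDiff_eq hdesc u
    exact ⟨v, hv, (key v₀ v hv1 hv (hv3.trans hvu.symm)).2 hv2, hvu⟩

end Transport

theorem IsLocalExtension.eventually_good {α : dualNullCone g τ} (h : IsLocalExtension g τ α F) :
    ∀ᶠ β in 𝓝 (α : CotangentBundle n M),
      F β ∈ (extChartAt (𝓡 (2 * n - 3)) (toLeaf g τ α)).source ∧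
      β ∈ (extChartAt (cotangentModel n) (α : CotangentBundle n M)).source ∧
      (g.energy β = 0 → β ∈ dualNullCone g τ) ∧
      ∀ hβ : β ∈ dualNullCone g τ, IsLocalExtension g τ ⟨β, hβ⟩ F := by
  obtain ⟨U, hU, hαU, hFU⟩ := h.exists_nhd
  have hsrc := h.contMDiffAt.continuousAt.eventually
    ((isOpen_extChartAt_source (I := 𝓡 (2 * n - 3)) (toLeaf g τ α)).mem_nhds
      (by rw [h.apply_eq]; exact mem_extChartAt_source _))
  filter_upwards [hU.mem_nhds hαU, hsrc, extChartAt_source_mem_nhds (I := cotangentModel n)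
    (α : CotangentBundle n M), eventually_mem_dualNullCone τ α.2] with β h1 h2 h3 h4
  exact ⟨h2, h3, h4, fun hβ => ((hFU β h1).2 hβ).2⟩

/-- The curve stays in one leaf, so all these subspaces lie in the same tangent space of the leaf
space. In the chart at `c t₀` the curve is characteristic for `p dq` on the zero energy level, and
`eventually_kernel_iff_of_characteristic` applies to `energyRep`. -/
theorem leafKernel_eventually_eq (hn : 2 ≤ n) (hdesc : SmoothStructureDescends g τ)
    {c : ℝ → CotangentBundle n M}
    (hcs : ContMDiff 𝓘(ℝ, ℝ) (cotangentModel n) ∞ c) (hc : ∀ t, c t ∈ dualNullCone g τ)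
    (hct : ∀ t, tanMap 𝓘(ℝ, ℝ) (cotangentModel n) c t 1 ∈ nullDist g (c t)) (t₀ : ℝ) :
    ∀ᶠ t in 𝓝 t₀, leafKernel hdesc ⟨c t, hc t⟩ = leafKernel hdesc ⟨c t₀, hc t₀⟩ := by
  obtain ⟨F, hF, -⟩ := hdesc ⟨c t₀, hc t₀⟩
  have hleaf : ∀ t, toLeaf g τ ⟨c t, hc t⟩ = toLeaf g τ ⟨c t₀, hc t₀⟩ := fun t => by
    rw [toLeaf_eq_of_tangentCurve hcs hc hct t, toLeaf_eq_of_tangentCurve hcs hc hct t₀]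
  have hgood := hF.eventually_good
  have hgoodt := (hcs t₀).continuousAt.eventually hgood
  have hh : ContDiffAt ℝ 2 (energyRep F (c t₀) (toLeaf g τ ⟨c t₀, hc t₀⟩))
      (extChartAt (cotangentModel n) (c t₀) (c t₀)) := by
    refine (energyRep_contDiffAt (mem_extChartAt_target _) ?_ ?_).of_le
      (WithTop.coe_le_coe.2 (le_top : (2 : ℕ∞) ≤ ⊤))
    · rw [extChartAt_to_inv]; exact hF.contMDiffAt
    · rw [extChartAt_to_inv]; exact hgood.self_of_nhds.1
  have hker : ∀ᶠ z in 𝓝 (extChartAt (cotangentModel n) (c t₀) (c t₀)),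
      (energyRep F (c t₀) (toLeaf g τ ⟨c t₀, hc t₀⟩) z).1 = 0 → ∀ v,
        fderiv ℝ (energyRep F (c t₀) (toLeaf g τ ⟨c t₀, hc t₀⟩)) z v = 0 →
          canonicalOneForm n z v = 0 := by
    filter_upwards [(tendsto_extChartAt_symm (c t₀)).eventually hgood,
      extChartAt_target_mem_nhds (I := cotangentModel n) (c t₀)] with z hz hzt hzE v hv
    exact (hz.2.2.2 (hz.2.2.1 hzE)).canonicalOneForm_eq_zero hn hdesc hzt _ hz.1 hv
  have hne : ∃ w, (fderiv ℝ (energyRep F (c t₀) (toLeaf g τ ⟨c t₀, hc t₀⟩))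
      (extChartAt (cotangentModel n) (c t₀) (c t₀)) w).1 = 0 ∧
        canonicalOneForm n (extChartAt (cotangentModel n) (c t₀) (c t₀)) w ≠ 0 := by
    obtain ⟨w, hw1, hw2⟩ := g.exists_liouville_ne_zero (c t₀) (cov_ne_zero_of_mem τ (hc t₀))
    refine ⟨w, (congrArg Prod.fst (fderiv_energyRep_self hF w)).trans hw1, ?_⟩
    rw [canonicalOneForm_apply, extChartAt_self_snd, ← liouville_eq]
    exact hw2
  have hcurve : ∀ᶠ t in 𝓝 t₀, (energyRep F (c t₀) (toLeaf g τ ⟨c t₀, hc t₀⟩)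
      (extChartAt (cotangentModel n) (c t₀) (c t))).1 = 0 ∧
      ∃ y', HasDerivAt (fun s => extChartAt (cotangentModel n) (c t₀) (c s)) y' t ∧
        fderiv ℝ (energyRep F (c t₀) (toLeaf g τ ⟨c t₀, hc t₀⟩))
          (extChartAt (cotangentModel n) (c t₀) (c t)) y' = 0 ∧
        ∃ b : ℝ, ∀ w, (fderiv ℝ (energyRep F (c t₀) (toLeaf g τ ⟨c t₀, hc t₀⟩))
          (extChartAt (cotangentModel n) (c t₀) (c t)) w).1 = 0 →
          fderiv ℝ (canonicalOneForm n) (extChartAt (cotangentModel n) (c t₀) (c t)) y' w -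
            fderiv ℝ (canonicalOneForm n) (extChartAt (cotangentModel n) (c t₀) (c t)) w y' =
              b * canonicalOneForm n (extChartAt (cotangentModel n) (c t₀) (c t)) w := by
    filter_upwards [hgoodt] with t ht
    obtain ⟨h1, h2, -, h4⟩ := ht
    have hinv := (extChartAt (cotangentModel n) (c t₀)).left_inv h2
    obtain ⟨y', hy', hvel⟩ := tanMap_symm_deriv hcs h2
    refine ⟨?_, y', hy', (h4 (hc t)).fderiv_energyRep_extChartAt (hc t) h2 h1 (by
      rw [hvel]; exact hct t)⟩
    change g.energy ((extChartAt (cotangentModel n) (c t₀)).symm _) = 0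
    rw [hinv, energy_eq_zero_of_mem τ (hc t)]
  have hs := fderiv_energyRep_surjective hdesc hF
  have hmain := eventually_kernel_iff_of_characteristic
    (h := energyRep F (c t₀) (toLeaf g τ ⟨c t₀, hc t₀⟩)) (θ := canonicalOneForm n)
    (y := fun t => extChartAt (cotangentModel n) (c t₀) (c t)) (t₀ := t₀) hh
    (canonicalOneForm n).contDiff.contDiffAt hs hker hne hcurve
  filter_upwards [hmain, hgoodt] with t ht ht2
  exact leafKernel_eq_of_coordinates hdesc hF (ht2.2.2.2 (hc t)) ht2.2.1 (hleaf t) ht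

/-- The subspace is locally constant in the curve parameter, and `ℝ` is connected. -/
theorem leafKernel_eq_of_joined (hn : 2 ≤ n) (hdesc : SmoothStructureDescends g τ)
    {α β : dualNullCone g τ} (h : JoinedByTangentCurve g τ α β) :
    leafKernel hdesc α = leafKernel hdesc β := by
  obtain ⟨c, hcs, h0, h1, hc⟩ := (joinedByTangentCurve_iff τ α β).1 h
  have h2 : IsLocallyConstant fun t => leafKernel hdesc ⟨c t, (hc t).1⟩ :=
    (IsLocallyConstant.iff_eventually_eq _).2 fun t =>
      leafKernel_eventually_eq hn hdesc hcs (fun t => (hc t).1) (fun t => (hc t).2) t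
  have h3 := h2.apply_eq_of_preconnectedSpace 0 1
  have e0 : (⟨c 0, (hc 0).1⟩ : dualNullCone g τ) = α := Subtype.ext h0
  have e1 : (⟨c 1, (hc 1).1⟩ : dualNullCone g τ) = β := Subtype.ext h1
  rwa [e0, e1] at h3

theorem leafKernel_eq_of_toLeaf_eq (hn : 2 ≤ n) (hdesc : SmoothStructureDescends g τ)
    {α β : dualNullCone g τ} (h : toLeaf g τ α = toLeaf g τ β) :
    leafKernel hdesc α = leafKernel hdesc β := by
  have h1 : Relation.EqvGen (JoinedByTangentCurve g τ) α β := Quotient.exact h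
  clear h
  induction h1 with
  | rel _ _ h => exact leafKernel_eq_of_joined hn hdesc h
  | refl _ => rfl
  | symm _ _ _ ih => exact ih.symm
  | trans _ _ _ _ _ ih1 ih2 => exact ih1.trans ih2

/-- A field of subspaces of the model vector space is induced by `ker θ`. -/
theorem isInducedByLiouville_iff (D : NullGeodesicSpace g τ → Submodule ℝ (Euc (2 * n - 3))) :
    IsInducedByLiouville g τ D ↔ ∀ (α : dualNullCone g τ)
      (F : CotangentBundle n M → NullGeodesicSpace g τ), IsLocalExtension g τ α F →
        ∀ v : Phase n, g.energyDeriv (α : CotangentBundle n M) v = 0 →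
          (extDiff F α v ∈ D (F α) ↔ liouville (α : CotangentBundle n M) v = 0) :=
  Iff.rfl

/-- The subspace at a leaf is read off at an arbitrary representative; invariance along the leaf
makes it correct at all the others. -/
theorem exists_isInducedByLiouville (hn : 2 ≤ n) (hdesc : SmoothStructureDescends g τ) :
    ∃ D : NullGeodesicSpace g τ → Submodule ℝ (Euc (2 * n - 3)), IsInducedByLiouville g τ D := by
  refine ⟨fun κ => leafKernel hdesc (Quotient.out κ), ?_⟩
  rw [isInducedByLiouville_iff]
  intro α F hF v hv
  rw [← extDiff_mem_leafKernel_iff hn hdesc hF hv]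
  have h1 : leafKernel hdesc (Quotient.out (F α)) = leafKernel hdesc α := by
    apply leafKernel_eq_of_toLeaf_eq hn hdesc
    rw [hF.apply_eq]
    exact Quotient.out_eq _
  rw [h1]

/-- The differential of the projection is onto, and a subspace is determined by its preimage under a
surjection. -/
theorem isInducedByLiouville_unique (hdesc : SmoothStructureDescends g τ)
    {D D' : NullGeodesicSpace g τ → Submodule ℝ (Euc (2 * n - 3))}
    (h : IsInducedByLiouville g τ D) (h' : IsInducedByLiouville g τ D') : D = D' := by
  rw [isInducedByLiouville_iff] at h h'
  funext κ
  obtain ⟨α, rfl⟩ : ∃ α, toLeaf g τ α = κ := Quotient.exists_rep κ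
  obtain ⟨F, hF, -⟩ := hdesc α
  ext u
  obtain ⟨v, hv, rfl⟩ := hF.exists_extDiff_eq hdesc u
  rw [← hF.apply_eq, h α F hF v hv, h' α F hF v hv]

end Invariance

/-! ### Smoothness of 1-forms from coordinate expressions. -/

section SmoothForms

variable {E H N : Type*} [NormedAddCommGroup E] [NormedSpace ℝ E] [TopologicalSpace H]
  [TopologicalSpace N] [ChartedSpace H N] {I : ModelWithCorners ℝ E H} [I.Boundaryless]

/-- A 1-form is smooth if its coordinate expressions are. -/
theorem isSmoothOneFormOn_of_formInChart [IsManifold I ∞ N] [IsManifold I 1 N]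
    {η : N → E →L[ℝ] ℝ} {U : Set N}
    (h : ∀ x ∈ U, ContDiffAt ℝ ∞ (formInChart I η x) (extChartAt I x x)) :
    IsSmoothOneFormOn I η U := by
  intro x₀ hx₀
  refine ContMDiffAt.contMDiffWithinAt ((contMDiffAt_hom_bundle _).2 ⟨contMDiffAt_id, ?_⟩)
  have h1 : ContMDiffAt I 𝓘(ℝ, E →L[ℝ] ℝ) ∞
      (fun x => formInChart I η x₀ (extChartAt I x₀ x)) x₀ :=
    (h x₀ hx₀).contMDiffAt.comp x₀ contMDiffAt_extChartAt
  refine h1.congr_of_eventuallyEq ?_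
  filter_upwards [extChartAt_source_mem_nhds (I := I) x₀] with x hx
  have h' : x ∈ (chartAt H x₀).source := by simpa using hx
  have h2 := TangentBundle.symmL_trivializationAt (I := I) h'
  rw [ModelWithCorners.range_eq_univ, mfderivWithin_univ] at h2
  ext v
  rw [formInChart_apply, (extChartAt I x₀).left_inv hx]
  simp only [ContinuousLinearMap.inCoordinates, h2]
  simp
  rfl

end SmoothForms

/-! ### Pullbacks of the Liouville form. -/

section Pullback

variable {n : ℕ} {M : Type*} [TopologicalSpace M] [ChartedSpace (Euc n) M]
  [IsManifold (𝓡 n) ∞ M]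

/-- In the canonical chart at `f y₀` the pullback is `p dq` composed with the derivative of the
coordinate expression of `f`. -/
theorem liouville_comp_tanMap_contDiffAt {P : Type*} [NormedAddCommGroup P] [NormedSpace ℝ P]
    {f : P → CotangentBundle n M} {y₀ : P} (hf : ContMDiffAt 𝓘(ℝ, P) (cotangentModel n) ∞ f y₀) :
    ContDiffAt ℝ ∞
      (fun y => (liouville (f y)).comp (tanMap 𝓘(ℝ, P) (cotangentModel n) f y)) y₀ := by
  have hs : ContDiffAt ℝ ∞ (fun y => extChartAt (cotangentModel n) (f y₀) (f y)) y₀ := by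
    rw [← contMDiffAt_iff_contDiffAt]
    exact (contMDiffAt_extChartAt (x := f y₀)).comp y₀ hf
  have h1 : ContDiffAt ℝ ∞ (fun y => (canonicalOneForm n
      (extChartAt (cotangentModel n) (f y₀) (f y))).comp
        (fderiv ℝ (fun y => extChartAt (cotangentModel n) (f y₀) (f y)) y)) y₀ :=
    ((canonicalOneForm n).contDiff.contDiffAt.comp y₀ hs).clm_comp
      (hs.fderiv_right (m := ∞) (by simp))
  refine h1.congr_of_eventuallyEq ?_
  have hsrc : ∀ᶠ y in 𝓝 y₀, f y ∈ (extChartAt (cotangentModel n) (f y₀)).source :=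
    hf.continuousAt.eventually ((isOpen_extChartAt_source (f y₀)).mem_nhds
      (mem_extChartAt_source (f y₀)))
  filter_upwards [hsrc.eventually_nhds,
    (hf.of_le (by simp : (1 : WithTop ℕ∞) ≤ ∞)).eventually_mdifferentiableAt] with y hy hyd
  have hy0 := hy.self_of_nhds
  have hyt := (extChartAt (cotangentModel n) (f y₀)).map_source hy0
  refine ContinuousLinearMap.ext fun v => ?_
  have e1 := liouville_tanMap_symm (f y₀) hyt
    (fderiv ℝ (fun y => extChartAt (cotangentModel n) (f y₀) (f y)) y v)
  have e2 : f =ᶠ[𝓝 y] fun u => (extChartAt (cotangentModel n) (f y₀)).symm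
      (extChartAt (cotangentModel n) (f y₀) (f u)) := by
    filter_upwards [hy] with u hu
    exact ((extChartAt (cotangentModel n) (f y₀)).left_inv hu).symm
  have hd : MDifferentiableAt 𝓘(ℝ, P) 𝓘(ℝ, Phase n)
      (fun y => extChartAt (cotangentModel n) (f y₀) (f y)) y :=
    (mdifferentiableAt_extChartAt_of_mem_source hy0).comp y hyd
  rw [ContinuousLinearMap.comp_apply, ContinuousLinearMap.comp_apply, canonicalOneForm_apply, ← e1,
    (extChartAt (cotangentModel n) (f y₀)).left_inv hy0, e2.tanMap_eq,
    tanMap_comp (g := (extChartAt (cotangentModel n) (f y₀)).symm)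
      (f := fun y => extChartAt (cotangentModel n) (f y₀) (f y))
      (mdifferentiableAt_extChartAt_symm hyt) hd, tanMap_eq_fderiv]
  rfl

variable {E H N : Type*} [NormedAddCommGroup E] [NormedSpace ℝ E] [TopologicalSpace H]
  [TopologicalSpace N] [ChartedSpace H N] (I : ModelWithCorners ℝ E H)

/-- The pullback of the canonical 1-form. -/
def liouvillePullback (s : N → CotangentBundle n M) (x : N) : E →L[ℝ] ℝ :=
  (liouville (s x)).comp (tanMap I (cotangentModel n) s x)

variable {I} [I.Boundaryless] [IsManifold I ∞ N]

theorem formInChart_liouvillePullback {s : N → CotangentBundle n M} {x : N}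
    (hs : ContMDiffAt I (cotangentModel n) ∞ s x) :
    formInChart I (liouvillePullback I s) x =ᶠ[𝓝 (extChartAt I x x)]
      fun y => (liouville (s ((extChartAt I x).symm y))).comp
        (tanMap 𝓘(ℝ, E) (cotangentModel n) (fun y => s ((extChartAt I x).symm y)) y) := by
  have : IsManifold I 1 N := IsManifold.of_le (n := ∞) (by simp)
  have h1 := (hs.of_le (by simp : (1 : WithTop ℕ∞) ≤ ∞)).eventually_mdifferentiableAt
  have h2 := (continuousAt_extChartAt_symm (I := I) x).tendsto
  rw [extChartAt_to_inv] at h2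
  filter_upwards [h2.eventually h1, extChartAt_target_mem_nhds (I := I) x] with y hy hyt
  rw [tanMap_comp hy (mdifferentiableAt_extChartAt_symm hyt)]
  rfl

theorem contMDiffAt_comp_extChartAt_symm {s : N → CotangentBundle n M} {x : N}
    (hs : ContMDiffAt I (cotangentModel n) ∞ s x) :
    ContMDiffAt 𝓘(ℝ, E) (cotangentModel n) ∞ (fun y => s ((extChartAt I x).symm y))
      (extChartAt I x x) :=
  hs.comp_of_eq (contMDiffAt_extChartAt_symm (mem_extChartAt_target x)) (extChartAt_to_inv x)

theorem liouvillePullback_contDiffAt {s : N → CotangentBundle n M} {x : N}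
    (hs : ContMDiffAt I (cotangentModel n) ∞ s x) :
    ContDiffAt ℝ ∞ (formInChart I (liouvillePullback I s) x) (extChartAt I x x) :=
  (liouville_comp_tanMap_contDiffAt (contMDiffAt_comp_extChartAt_symm hs)).congr_of_eventuallyEq
    (formInChart_liouvillePullback hs)

/-- This is `d(s^*θ) = s^*dθ`, obtained by applying `formDeriv_pullback` to `s` read in the chart at
`x`. -/
theorem formDeriv_liouvillePullback {s : N → CotangentBundle n M} {x : N}
    (hs : ContMDiffAt I (cotangentModel n) ∞ s x) (v w : E) :
    formDeriv I (liouvillePullback I s) x v w =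
      formDeriv (cotangentModel n) (liouville (n := n) (M := M)) (s x)
        (tanMap I (cotangentModel n) s x v) (tanMap I (cotangentModel n) s x w) := by
  have : IsManifold I 1 N := IsManifold.of_le (n := ∞) (by simp)
  have h1 := formDeriv_pullback (cotangentModel n) (liouville (n := n) (M := M))
    (fun y => s ((extChartAt I x).symm y)) (extChartAt I x x)
    ((contMDiffAt_comp_extChartAt_symm hs).of_le (WithTop.coe_le_coe.2 (le_top : (2 : ℕ∞) ≤ ⊤)))
    (differentiableAt_formInChart_liouville _) (formInChart I (liouvillePullback I s) x)
    (formInChart_liouvillePullback hs) v w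
  have h2 : MDifferentiableAt I (cotangentModel n) s
      ((extChartAt I x).symm (extChartAt I x x)) := by
    rw [extChartAt_to_inv]
    exact hs.mdifferentiableAt (by simp)
  rw [tanMap_comp h2 (mdifferentiableAt_extChartAt_symm (mem_extChartAt_target x)),
    tanMap_extChartAt_symm_self, ContinuousLinearMap.comp_id] at h1
  simp only [extChartAt_to_inv] at h1
  rw [formDeriv_eq, h1]

end Pullback

/-! ### Local sections and the contact condition. -/

section Contact

variable {n : ℕ} {M : Type*} [TopologicalSpace M] [ChartedSpace (Euc n) M]
  [IsManifold (𝓡 n) ∞ M] {g : LorentzianMetric n M} {τ : TimeOrientation g}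
  [ChartedSpace (Euc (2 * n - 3)) (NullGeodesicSpace g τ)]
  [IsManifold (𝓡 (2 * n - 3)) ∞ (NullGeodesicSpace g τ)]

/-- A smooth local section of the projection to the leaf space, on an open set. -/
structure IsLocalSection (F : CotangentBundle n M → NullGeodesicSpace g τ)
    (s : NullGeodesicSpace g τ → CotangentBundle n M) (V : Set (NullGeodesicSpace g τ)) : Prop where
  isOpen : IsOpen V
  contMDiffAt : ∀ κ ∈ V, ContMDiffAt (𝓡 (2 * n - 3)) (cotangentModel n) ∞ s κ
  mem : ∀ κ ∈ V, s κ ∈ dualNullCone g τ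
  isLocalExtension : ∀ κ (h : s κ ∈ dualNullCone g τ), κ ∈ V → IsLocalExtension g τ ⟨s κ, h⟩ F
  apply_eq : ∀ κ ∈ V, F (s κ) = κ

/-- A local section of the submersion `energyRep` is restricted to the slice `{0} × ℝ^(2n-3)`: its
values have zero energy and are close to `α`, hence lie in the future null cone. -/
theorem exists_isLocalSection (hdesc : SmoothStructureDescends g τ) (κ₀ : NullGeodesicSpace g τ) :
    ∃ F s V, IsLocalSection (g := g) (τ := τ) F s V ∧ κ₀ ∈ V := by
  obtain ⟨α, rfl⟩ : ∃ α, toLeaf g τ α = κ₀ := Quotient.exists_rep κ₀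
  obtain ⟨F, hF, -⟩ := hdesc α
  obtain ⟨U, hU, hαU, hFU⟩ := hF.exists_nhd
  obtain ⟨O', hO'sub, hO', hαO'⟩ := mem_nhds_iff.1 (hF.eventually_good.and (hU.mem_nhds hαU))
  have hO := (continuousOn_extChartAt_symm (I := cotangentModel n)
    (α : CotangentBundle n M)).isOpen_inter_preimage (isOpen_extChartAt_target _) hO'
  have hsurj := fderiv_energyRep_surjective hdesc hF
  obtain ⟨r, W, hW, hW0, -, hr⟩ := exists_contDiffOn_section hO
    (h := energyRep F α (toLeaf g τ α)) (fun z hz => energyRep_contDiffAt hz.1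
      (hFU _ (hO'sub hz.2).2).1 (hO'sub hz.2).1.1)
    ⟨mem_extChartAt_target _, by rw [Set.mem_preimage, extChartAt_to_inv]; exact hαO'⟩ hsurj
  have h0 : energyRep F α (toLeaf g τ α) (extChartAt (cotangentModel n) (α : CotangentBundle n M) α)
      = (0, extChartAt (𝓡 (2 * n - 3)) (toLeaf g τ α) (toLeaf g τ α)) := by
    refine Prod.ext ?_ ?_
    · change g.energy ((extChartAt (cotangentModel n) (α : CotangentBundle n M)).symm _) = 0
      rw [extChartAt_to_inv, energy_eq_zero_of_mem τ α.2]
    · change extChartAt (𝓡 (2 * n - 3)) _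
        (F ((extChartAt (cotangentModel n) (α : CotangentBundle n M)).symm _)) = _
      rw [extChartAt_to_inv, hF.apply_eq]
  rw [h0] at hW0
  have hemb : Continuous fun u : Euc (2 * n - 3) => ((0 : ℝ), u) := by fun_prop
  set ψ := extChartAt (𝓡 (2 * n - 3)) (toLeaf g τ α) with hψ
  have hV : IsOpen (ψ.source ∩ ψ ⁻¹' ((fun u : Euc (2 * n - 3) => ((0 : ℝ), u)) ⁻¹' W)) :=
    (continuousOn_extChartAt (toLeaf g τ α)).isOpen_inter_preimage (isOpen_extChartAt_source _)
      (hW.preimage hemb)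
  have hmem : ∀ κ ∈ ψ.source ∩ ψ ⁻¹' ((fun u : Euc (2 * n - 3) => ((0 : ℝ), u)) ⁻¹' W),
      (extChartAt (cotangentModel n) (α : CotangentBundle n M)).symm (r (0, ψ κ)) ∈
        dualNullCone g τ ∧
      F ((extChartAt (cotangentModel n) (α : CotangentBundle n M)).symm (r (0, ψ κ))) = κ := by
    intro κ hκ
    obtain ⟨-, h2, h3⟩ := hr _ hκ.2
    have h4 := (hO'sub h2.2).1
    exact ⟨h4.2.2.1 (congrArg Prod.fst h3), ψ.injOn h4.1 hκ.1 (congrArg Prod.snd h3)⟩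
  refine ⟨F, fun κ => (extChartAt (cotangentModel n) (α : CotangentBundle n M)).symm (r (0, ψ κ)),
    _, ⟨hV, fun κ hκ => ?_, fun κ hκ => (hmem κ hκ).1, fun κ h hκ => ?_, fun κ hκ => (hmem κ hκ).2⟩,
    mem_extChartAt_source _, hW0⟩
  · obtain ⟨h1, h2, -⟩ := hr _ hκ.2
    have h3 : ContDiffAt ℝ ∞ (fun u : Euc (2 * n - 3) => r (0, u)) (ψ κ) :=
      h1.comp (ψ κ) (contDiffAt_const.prodMk contDiffAt_id)
    have h4 : ContMDiffAt (𝓡 (2 * n - 3)) 𝓘(ℝ, Euc (2 * n - 3)) ∞ ψ κ :=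
      contMDiffAt_extChartAt' (by simpa [hψ] using hκ.1)
    exact (contMDiffAt_extChartAt_symm (I := cotangentModel n) h2.1).comp κ
      (h3.contMDiffAt.comp κ h4)
  · exact (hO'sub (hr _ hκ.2).2.1.2).1.2.2.2 h

namespace IsLocalSection

variable {F : CotangentBundle n M → NullGeodesicSpace g τ}
  {s : NullGeodesicSpace g τ → CotangentBundle n M} {V : Set (NullGeodesicSpace g τ)}
  {κ : NullGeodesicSpace g τ}

theorem extDiff_tanMap (h : IsLocalSection F s V) (hκ : κ ∈ V) (v : Euc (2 * n - 3)) :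
    extDiff F (s κ) (tanMap (𝓡 (2 * n - 3)) (cotangentModel n) s κ v) = v := by
  have h1 : (fun z => F (s z)) =ᶠ[𝓝 κ] fun z => z := by
    filter_upwards [h.isOpen.mem_nhds hκ] with z hz using h.apply_eq z hz
  have h2 := h1.tanMap_eq (I := 𝓡 (2 * n - 3)) (I' := 𝓡 (2 * n - 3))
  have h3 : ContMDiffAt (cotangentModel n) (𝓡 (2 * n - 3)) ∞ F (s κ) :=
    (h.isLocalExtension κ (h.mem κ hκ) hκ).contMDiffAt
  rw [tanMap_id, tanMap_comp (h3.mdifferentiableAt (by simp))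
    ((h.contMDiffAt κ hκ).mdifferentiableAt (by simp))] at h2
  exact DFunLike.congr_fun h2 v

theorem energyDeriv_tanMap (h : IsLocalSection F s V) (hκ : κ ∈ V) (v : Euc (2 * n - 3)) :
    g.energyDeriv (s κ) (tanMap (𝓡 (2 * n - 3)) (cotangentModel n) s κ v) = 0 := by
  have h1 : (fun z => g.energy (s z)) =ᶠ[𝓝 κ] fun _ => (0 : ℝ) := by
    filter_upwards [h.isOpen.mem_nhds hκ] with z hz using energy_eq_zero_of_mem τ (h.mem z hz)
  have h2 := h1.tanMap_eq (I := 𝓡 (2 * n - 3)) (I' := 𝓘(ℝ, ℝ))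
  rw [tanMap_const, tanMap_comp ((g.energy_contMDiff _).mdifferentiableAt (by simp))
    ((h.contMDiffAt κ hκ).mdifferentiableAt (by simp))] at h2
  exact DFunLike.congr_fun h2 v

variable {D : NullGeodesicSpace g τ → Submodule ℝ (Euc (2 * n - 3))}

theorem extDiff_mem_iff (h : IsLocalSection F s V) (hD : IsInducedByLiouville g τ D) (hκ : κ ∈ V)
    {w : Phase n} (hw : g.energyDeriv (s κ) w = 0) :
    extDiff F (s κ) w ∈ D κ ↔ liouville (s κ) w = 0 := by
  have h1 := (isInducedByLiouville_iff D).1 hD ⟨s κ, h.mem κ hκ⟩ F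
    (h.isLocalExtension κ (h.mem κ hκ) hκ) w hw
  rwa [h.apply_eq κ hκ] at h1

theorem mem_iff (h : IsLocalSection F s V) (hD : IsInducedByLiouville g τ D) (hκ : κ ∈ V)
    (v : Euc (2 * n - 3)) :
    v ∈ D κ ↔ liouvillePullback (𝓡 (2 * n - 3)) s κ v = 0 := by
  have h1 := h.extDiff_mem_iff hD hκ (h.energyDeriv_tanMap hκ v)
  rwa [h.extDiff_tanMap hκ] at h1

/-- If `s^*θ` vanished at `κ`, then `D κ` would be everything and `θ` would vanish on all vectors
tangent to the cone at `s κ`. -/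
theorem liouvillePullback_ne_zero (h : IsLocalSection F s V) (hD : IsInducedByLiouville g τ D)
    (hκ : κ ∈ V) : liouvillePullback (𝓡 (2 * n - 3)) s κ ≠ 0 := by
  intro h0
  obtain ⟨w, hw, hw2⟩ := g.exists_liouville_ne_zero (s κ) (cov_ne_zero_of_mem τ (h.mem κ hκ))
  refine hw2 ((h.extDiff_mem_iff hD hκ hw).1 ((h.mem_iff hD hκ _).2 ?_))
  rw [h0]
  rfl

/-- A degenerate direction `v` lifts by `ds` to a characteristic direction of `dθ` on `ker dE_g ∩
ker θ`, that is, to a vector along the leaf, and the projection kills it. -/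
theorem eq_zero_of_formDeriv_eq_zero (hn : 2 ≤ n) (hdesc : SmoothStructureDescends g τ)
    (h : IsLocalSection F s V) (hD : IsInducedByLiouville g τ D) (hκ : κ ∈ V)
    {v : Euc (2 * n - 3)} (hv : v ∈ D κ) (hvw : ∀ w ∈ D κ,
      formDeriv (𝓡 (2 * n - 3)) (liouvillePullback (𝓡 (2 * n - 3)) s) κ v w = 0) : v = 0 := by
  have hE := h.isLocalExtension κ (h.mem κ hκ) hκ
  have hT := h.energyDeriv_tanMap hκ
  have key : ∃ a b : ℝ, tanMap (𝓡 (2 * n - 3)) (cotangentModel n) s κ v =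
      a • g.cogeodesic (s κ) + b • euler (s κ) := by
    refine g.mem_span_of_formDeriv_eq_zero (s κ) _ fun w hw hw2 => ?_
    have h1 := hvw _ ((h.extDiff_mem_iff hD hκ hw).2 hw2)
    rw [formDeriv_liouvillePullback (h.contMDiffAt κ hκ)] at h1
    -- An arbitrary test vector `w` need not be in the image of `ds`, but `w - ds(dF w)` is a
    -- combination of `X_g` and `ξ`. Its `ω`-pairing with `ds v` is a combination of `dE_g(ds v) =
    -- 0` and `θ(ds v) = 0`, so `w` may be replaced by `ds(dF w)`.
    obtain ⟨a, b, hab⟩ := hE.exists_eq_of_extDiff_eq_zero hn hdesc (v := w -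
      tanMap (𝓡 (2 * n - 3)) (cotangentModel n) s κ (extDiff F (s κ) w)) (by
        rw [map_sub, hT, hw, sub_zero]) (by
        rw [map_sub, h.extDiff_tanMap hκ, sub_self])
    have h2 : liouville (s κ) (tanMap (𝓡 (2 * n - 3)) (cotangentModel n) s κ v) = 0 :=
      (h.mem_iff hD hκ v).1 hv
    have h3 := symplecticEquiv_apply (w -
      tanMap (𝓡 (2 * n - 3)) (cotangentModel n) s κ (extDiff F (s κ) w))
      (tanMap (𝓡 (2 * n - 3)) (cotangentModel n) s κ v)
    rw [hab, map_add, map_smul, map_smul, g.symplecticEquiv_cogeodesic,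
      LorentzianMetric.symplecticEquiv_euler, add_apply, smul_apply, smul_apply, neg_apply, hT, h2,
      ← hab, Prod.fst_sub, Prod.snd_sub, map_sub, sub_apply] at h3
    rw [formDeriv_liouville] at h1 ⊢
    simp only [smul_eq_mul, mul_zero, neg_zero, add_zero] at h3
    linarith
  obtain ⟨a, b, hab⟩ := key
  -- `dF` is a left inverse of `ds` and annihilates both `X_g` and `ξ`.
  rw [← h.extDiff_tanMap hκ v, hab, map_add, map_smul, map_smul, hE.extDiff_cogeodesic,
    hE.extDiff_euler, smul_zero, smul_zero, add_zero]

theorem isSmoothOneFormOn (h : IsLocalSection F s V) :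
    IsSmoothOneFormOn (𝓡 (2 * n - 3)) (liouvillePullback (𝓡 (2 * n - 3)) s) V :=
  isSmoothOneFormOn_of_formInChart fun κ hκ => liouvillePullback_contDiffAt (h.contMDiffAt κ hκ)

end IsLocalSection

theorem isContactStructure_of_isInducedByLiouville (hn : 2 ≤ n)
    (hdesc : SmoothStructureDescends g τ)
    {D : NullGeodesicSpace g τ → Submodule ℝ (Euc (2 * n - 3))} (hD : IsInducedByLiouville g τ D) :
    IsContactStructure (𝓡 (2 * n - 3)) D := by
  intro κ₀
  obtain ⟨F, s, V, h, hκ₀⟩ := exists_isLocalSection hdesc κ₀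
  exact ⟨V, h.isOpen, hκ₀, liouvillePullback (𝓡 (2 * n - 3)) s, h.isSmoothOneFormOn, fun κ hκ =>
    ⟨h.liouvillePullback_ne_zero hD hκ, h.mem_iff hD hκ,
      fun v hv hvw => h.eq_zero_of_formDeriv_eq_zero hn hdesc hD hκ hv hvw⟩⟩

end Contact

end

theorem proposition2p1 (n : ℕ) (hn : 2 ≤ n) (M : Type*) [TopologicalSpace M] [T2Space M]
    [SecondCountableTopology M] [ChartedSpace (Euc n) M] [IsManifold (𝓡 n) ∞ M]
    (g : LorentzianMetric n M) (τ : TimeOrientation g)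
    [ChartedSpace (Euc (2 * n - 3)) (NullGeodesicSpace g τ)]
    [IsManifold (𝓡 (2 * n - 3)) ∞ (NullGeodesicSpace g τ)]
    (hdesc : SmoothStructureDescends g τ) :
    (∃! D : (∀ κ : NullGeodesicSpace g τ, Submodule ℝ (TangentSpace (𝓡 (2 * n - 3)) κ)),
      IsInducedByLiouville g τ D) ∧
    ∀ D : (∀ κ : NullGeodesicSpace g τ, Submodule ℝ (TangentSpace (𝓡 (2 * n - 3)) κ)),
      IsInducedByLiouville g τ D → IsContactStructure (𝓡 (2 * n - 3)) D := by
  obtain ⟨D, hD⟩ := exists_isInducedByLiouville hn hdesc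
  exact ⟨⟨D, hD, fun D' hD' => isInducedByLiouville_unique hdesc hD' hD⟩,
    fun D' hD' => isContactStructure_of_isInducedByLiouville hn hdesc hD'⟩
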